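/- For $f:\{0,1\}^n\to\mathbb R$, with $\{0,1\}^n$ identified with $\mathbb F_2^n$, let $$\|f\|_{U_3}=\Big[\mathbb E_{x,y_1,y_2,y_3}\prod_{S\subseteq\{1,2,3\}} f\Big(x+\sum_{i\in S}y_i\Big)\Big]^{1/8},$$ where $x,y_1,y_2,y_3$ are independent and uniform in $\mathbb F_2^n$. The distance between two functions on $\{0,1\}^n$ is the fraction of points of $\{0,1\}^n$ at which they disagree. Theorem. There are absolute constants $C>0$ and $c>0$ such that the following holds. Let $n\ge 0$, let $f:\{0,1\}^n\to\{-1,1\}$ be a boolean function, and let $\epsilon>0$ be such that $\|f\|_{U_3}\ge\epsilon$. Then there is a polynomial $P\in\mathbb F_2[x_1,\dots,x_n]$ of degree at most $2$ such that the distance between $f$ and the function $g(x)=(-1)^{P(x)}$ is at most $\frac12-\epsilon'$, where $\epsilon'=c\exp\left(-\frac{1}{\epsilon^{C}}\right)$. -/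

import Mathlib

open scoped BigOperators

noncomputable section

/-- The cube `{0,1}^n`, identified with the vector space `𝔽₂ⁿ`. -/
abbrev Cube (n : ℕ) : Type := Fin n → ZMod 2

/-- The `d`-th Gowers uniformity norm (for the group `ℤ₂ⁿ`) of a real function on the cube:
`[ 𝔼_{x, y₁, …, y_d} ∏_{S ⊆ [d]} f (x + ∑_{i ∈ S} y_i) ] ^ (1 / 2^d)`. -/
def gowersNorm {n : ℕ} (d : ℕ) (f : Cube n → ℝ) : ℝ :=
  (𝔼 x : Cube n, 𝔼 y : Fin d → Cube n,
    ∏ S : Finset (Fin d), f (x + ∑ i ∈ S, y i)) ^ ((1 : ℝ) / 2 ^ d)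

/-- `f` takes only the values `-1` and `1`. -/
def IsBoolean {n : ℕ} (f : Cube n → ℝ) : Prop :=
  ∀ x, f x = -1 ∨ f x = 1

/-- `g` has a degree-`d` representation: `g x = (-1) ^ P(x)` for an `n`-variate polynomial `P`
over `𝔽₂` of total degree at most `d`. -/
def HasDegreeRepresentation {n : ℕ} (d : ℕ) (g : Cube n → ℝ) : Prop :=
  ∃ P : MvPolynomial (Fin n) (ZMod 2), P.totalDegree ≤ d ∧
    ∀ x, g x = (-1 : ℝ) ^ (MvPolynomial.eval x P).val

/-- The distance between two functions: the fraction of points at which they disagree. -/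
def fractionalDist {n : ℕ} (f g : Cube n → ℝ) : ℝ :=
  (hammingDist f g : ℝ) / 2 ^ n

end

/-! The eighth power of the `U_3` norm is a normalised fourth moment of the Fourier coefficients of
the derivatives `f x * f (x + y)`. Cauchy–Schwarz passes to the sixth moment, which
`sum_derivFt_triples` identifies with the weight of additive triples among pairs (direction,
frequency). Hence the set of pairs with a large coefficient contains many additive triples
(`card_largeSpectrum_triples`). Balog–Szemerédi–Gowers and Ruzsa covering put a sizeable part of it
in a subspace not much larger than itself, and slicing that subspace gives an affine map `y ↦ L y +
w` that often predicts a large coefficient (`exists_large_sum_derivFt`).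

It remains to integrate this linear description of the derivatives. Cauchy–Schwarz forces the form
`L x ⬝ᵥ y + L y ⬝ᵥ x` to have a large radical (`le_card_symmKernel`), so on a large subspace `K` the
map `L` agrees with an alternating form, the polarisation of a quadratic `P`. Multiplying `f` by the
phase of `P` makes the predicted frequency constant on a coset of `K`, and this yields one large
Fourier coefficient of the product (`exists_quadratic_correlation`). Its linear phase and sign are
absorbed into `P`.

The doubling constant is polynomial in `1/ε`; covering puts it in an exponent, whence the shape of
the bound. -/

variable {n : ℕ}

/-! ### Fourier analysis on the cube -/

/-- The sign character of `𝔽₂`. -/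
noncomputable def sgn (a : ZMod 2) : ℝ := (-1) ^ a.val

@[simp] theorem sgn_zero : sgn 0 = 1 := by simp [sgn]

theorem sgn_one : sgn 1 = -1 := by simp [sgn, ZMod.val_one]

theorem sgn_add (a b : ZMod 2) : sgn (a + b) = sgn a * sgn b := by
  have h : ∀ c : ZMod 2, c = 0 ∨ c = 1 := by decide
  have h2 : (1 : ZMod 2) + 1 = 0 := by decide
  rcases h a with rfl | rfl <;> rcases h b with rfl | rfl <;> simp [sgn_one, h2]

@[simp] theorem sgn_mul_self (a : ZMod 2) : sgn a * sgn a = 1 := by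
  rw [← sgn_add, ZModModule.add_self, sgn_zero]

@[simp] theorem sgn_sq (a : ZMod 2) : sgn a ^ 2 = 1 := by rw [sq, sgn_mul_self]

@[simp] theorem abs_sgn (a : ZMod 2) : |sgn a| = 1 := by simp [sgn, abs_pow]

theorem card_cube : (Fintype.card (Cube n) : ℝ) = 2 ^ n := by simp [Cube]

theorem Cube.add_add_cancel (x y : Cube n) : x + y + y = x := by
  rw [add_assoc, ZModModule.add_self, add_zero]

theorem Cube.add_eq_zero {x y : Cube n} : x + y = 0 ↔ x = y := by
  rw [← ZModModule.sub_eq_add, sub_eq_zero]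

/-- Translation invariance of sums over the cube. -/
theorem sum_cube_add_right {M : Type*} [AddCommMonoid M] (h : Cube n → M) (y : Cube n) :
    ∑ x, h (x + y) = ∑ x, h x :=
  Equiv.sum_comp (Equiv.addRight y) h

theorem sum_cube_add_left {M : Type*} [AddCommMonoid M] (h : Cube n → M) (y : Cube n) :
    ∑ x, h (y + x) = ∑ x, h x :=
  Equiv.sum_comp (Equiv.addLeft y) h

theorem sum_sgn_linear (l : Cube n →+ ZMod 2) :
    ∑ x, sgn (l x) = if l = 0 then 2 ^ n else 0 := by
  split_ifs with h
  · simp [h]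
  · obtain ⟨y, hy⟩ := DFunLike.ne_iff.1 h
    have hy1 : l y = 1 := (by decide : ∀ c : ZMod 2, c ≠ 0 → c = 1) _ hy
    have := sum_cube_add_right (fun x => sgn (l x)) y
    simp only [map_add, hy1, sgn_add, sgn_one, ← Finset.sum_mul] at this
    linarith

theorem sum_sgn_dotProduct (a : Cube n) :
    ∑ x, sgn (a ⬝ᵥ x) = if a = 0 then 2 ^ n else 0 := by
  let l : Cube n →+ ZMod 2 := AddMonoidHom.mk' (fun x => a ⬝ᵥ x) (fun x y => dotProduct_add a x y)
  have : l = 0 ↔ a = 0 := by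
    constructor
    · intro h
      exact dotProduct_eq_zero a fun w => DFunLike.congr_fun h w
    · rintro rfl
      ext x; simp [l]
  rw [← if_congr this rfl rfl]
  exact sum_sgn_linear l

/-- The (unnormalised) Fourier transform on the cube. -/
noncomputable def ft (h : Cube n → ℝ) (a : Cube n) : ℝ := ∑ x, h x * sgn (a ⬝ᵥ x)

theorem ft_ft (h : Cube n → ℝ) (x : Cube n) : ft (ft h) x = 2 ^ n * h x := by
  simp only [ft, Finset.sum_mul]
  rw [Finset.sum_comm]
  have : ∀ y : Cube n, ∑ a : Cube n, h y * sgn (a ⬝ᵥ y) * sgn (x ⬝ᵥ a) =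
      h y * if y = x then 2 ^ n else 0 := by
    intro y
    rw [← if_congr (Cube.add_eq_zero (x := y) (y := x)) rfl rfl, ← sum_sgn_dotProduct,
      Finset.mul_sum]
    refine Finset.sum_congr rfl fun a _ => ?_
    rw [add_dotProduct, sgn_add, dotProduct_comm a y, mul_assoc]
  rw [Finset.sum_congr rfl fun y _ => this y]
  simp [mul_comm]

theorem sum_ft_mul (h k : Cube n → ℝ) : ∑ a, ft h a * k a = ∑ x, h x * ft k x := by
  simp only [ft, Finset.sum_mul, Finset.mul_sum]
  rw [Finset.sum_comm]
  refine Finset.sum_congr rfl fun x _ => Finset.sum_congr rfl fun a _ => ?_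
  rw [dotProduct_comm]; ring

theorem sum_ft_mul_ft (h k : Cube n → ℝ) : ∑ a, ft h a * ft k a = 2 ^ n * ∑ x, h x * k x := by
  rw [sum_ft_mul, Finset.mul_sum]
  refine Finset.sum_congr rfl fun x _ => ?_
  rw [ft_ft]; ring

theorem sum_ft_sq (h : Cube n → ℝ) : ∑ a, ft h a ^ 2 = 2 ^ n * ∑ x, h x ^ 2 := by
  simpa only [sq] using sum_ft_mul_ft h h

theorem ft_add (h : Cube n → ℝ) (a b : Cube n) :
    ft h (a + b) = ft (fun x => h x * sgn (a ⬝ᵥ x)) b := by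
  simp only [ft, add_dotProduct, sgn_add, mul_assoc]

theorem sum_ft_mul_ft_add (h k : Cube n → ℝ) (a : Cube n) :
    ∑ b, ft h b * ft k (a + b) = 2 ^ n * ft (fun x => h x * k x) a := by
  simp only [ft_add]
  rw [sum_ft_mul_ft, ft]
  simp only [mul_assoc]

theorem sum_ft_mul_ft_mul_ft (h₁ h₂ h₃ : Cube n → ℝ) :
    ∑ a, ∑ b, ft h₁ a * ft h₂ b * ft h₃ (a + b) = (2 ^ n) ^ 2 * ∑ x, h₁ x * h₂ x * h₃ x := by
  simp only [mul_assoc, ← Finset.mul_sum, sum_ft_mul_ft_add]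
  simp only [← mul_assoc, mul_comm _ ((2 : ℝ) ^ n)]
  simp only [mul_assoc, ← Finset.mul_sum, sum_ft_mul_ft]
  ring

/-! ### Derivatives and the `U_3` norm -/

/-- The Fourier transform of the multiplicative derivative of `f` in direction `y`. -/
noncomputable def derivFt (f : Cube n → ℝ) (y a : Cube n) : ℝ := ft (fun x => f x * f (x + y)) a

/-- The autocorrelation of the multiplicative derivatives of `f`. -/
noncomputable def derivCorr (f : Cube n → ℝ) (y z : Cube n) : ℝ :=
  ∑ x, f x * f (x + y) * (f (x + z) * f (x + z + y))

theorem derivCorr_comm (f : Cube n → ℝ) (y z : Cube n) : derivCorr f y z = derivCorr f z y := by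
  refine Finset.sum_congr rfl fun x _ => ?_
  rw [add_right_comm x z y]; ring

theorem ft_sq (h : Cube n → ℝ) (a : Cube n) : ft h a ^ 2 = ft (fun z => ∑ x, h x * h (x + z)) a := by
  simp only [ft, sq, Finset.sum_mul, Finset.mul_sum]
  rw [Finset.sum_comm]
  conv_rhs => rw [Finset.sum_comm]
  refine Finset.sum_congr rfl fun x _ => ?_
  rw [← sum_cube_add_left _ x]
  refine Finset.sum_congr rfl fun z _ => ?_
  rw [dotProduct_add, sgn_add]
  linear_combination h x * h (x + z) * sgn (a ⬝ᵥ z) * sgn_mul_self (a ⬝ᵥ x)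

theorem derivFt_sq (f : Cube n → ℝ) (y a : Cube n) : derivFt f y a ^ 2 = ft (derivCorr f y) a :=
  ft_sq _ _

theorem IsBoolean.sq_eq_one {f : Cube n → ℝ} (hf : IsBoolean f) (x : Cube n) : f x ^ 2 = 1 := by
  rcases hf x with h | h <;> simp [h]

theorem sum_derivFt_sq {f : Cube n → ℝ} (hf : IsBoolean f) (y : Cube n) :
    ∑ a, derivFt f y a ^ 2 = (2 ^ n) ^ 2 := by
  simp only [derivFt]
  rw [sum_ft_sq]
  simp only [mul_pow, hf.sq_eq_one]
  simp [sq]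

/-- Parseval for `derivCorr f y`, whose transform is `derivFt f y a ^ 2`. -/
theorem sum_derivFt_pow_four (f : Cube n → ℝ) :
    ∑ y, ∑ a, derivFt f y a ^ 4 = 2 ^ n * ∑ y, ∑ z, derivCorr f y z ^ 2 := by
  rw [Finset.mul_sum]
  refine Finset.sum_congr rfl fun y _ => ?_
  rw [← sum_ft_sq]
  refine Finset.sum_congr rfl fun a _ => ?_
  rw [← derivFt_sq]; ring

/-- Samorodnitsky's identity: the additive structure of the Fourier coefficients of the derivatives
is governed by their sixth moment. -/
theorem sum_derivFt_triples (f : Cube n → ℝ) :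
    ∑ y, ∑ z, ∑ a, ∑ b, derivFt f y a ^ 2 * derivFt f z b ^ 2 * derivFt f (y + z) (a + b) ^ 2 =
      2 ^ n * ∑ y, ∑ a, derivFt f y a ^ 6 := by
  have h2 : (2 : ℝ) ^ n ≠ 0 := by positivity
  -- Both sides reduce to triple sums of `derivCorr`: the left by the triple identity in the
  -- frequencies, the right by the same identity in the directions, for a fixed shift `u`. The
  -- symmetry of `derivCorr` links the two.
  have key : ∀ u, (2 ^ n) ^ 3 * ∑ y, ∑ z, derivCorr f y u * derivCorr f z u * derivCorr f (y + z) u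
      = (2 ^ n) ^ 2 * ∑ a, derivFt f u a ^ 6 := by
    intro u
    have h := sum_ft_mul_ft_mul_ft (fun a => derivFt f u a ^ 2) (fun a => derivFt f u a ^ 2)
      (fun a => derivFt f u a ^ 2)
    have h3 : ∀ y, ft (fun a => derivFt f u a ^ 2) y = 2 ^ n * derivCorr f y u := by
      intro y
      simp only [derivFt_sq]
      rw [derivCorr_comm f y u]
      exact ft_ft (derivCorr f u) y
    simp only [h3] at h
    calc _ = ∑ a, ∑ b, 2 ^ n * derivCorr f a u * (2 ^ n * derivCorr f b u) *
              (2 ^ n * derivCorr f (a + b) u) := by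
          simp only [Finset.mul_sum]
          refine Finset.sum_congr rfl fun y _ => Finset.sum_congr rfl fun z _ => ?_
          ring
      _ = _ := by
          rw [h]
          congr 1
          refine Finset.sum_congr rfl fun a _ => ?_
          ring
  have key2 : ∀ u, 2 ^ n * ∑ y, ∑ z, derivCorr f y u * derivCorr f z u * derivCorr f (y + z) u
      = ∑ a, derivFt f u a ^ 6 := by
    intro u
    have := key u
    refine mul_left_cancel₀ (pow_ne_zero 2 h2) ?_
    rw [← this]; ring
  simp only [derivFt_sq f, sum_ft_mul_ft_mul_ft]
  simp only [← key2, Finset.mul_sum]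
  rw [Finset.sum_congr rfl fun y _ => Finset.sum_comm, Finset.sum_comm]
  refine Finset.sum_congr rfl fun u _ => Finset.sum_congr rfl fun y _ =>
    Finset.sum_congr rfl fun z _ => ?_
  ring

theorem sum_fin_three_fun {α M : Type*} [Fintype α] [AddCommMonoid M] (F : (Fin 3 → α) → M) :
    ∑ y, F y = ∑ a, ∑ b, ∑ c, F ![a, b, c] := by
  let e : α × α × α ≃ (Fin 3 → α) :=
    { toFun := fun p => ![p.1, p.2.1, p.2.2]
      invFun := fun y => (y 0, y 1, y 2)
      left_inv := fun p => rfl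
      right_inv := fun y => by ext i; fin_cases i <;> rfl }
  rw [← Equiv.sum_comp e, Fintype.sum_prod_type]
  refine Finset.sum_congr rfl fun a _ => ?_
  rw [Fintype.sum_prod_type]
  rfl

theorem prod_finset_fin_three {M : Type*} [CommMonoid M] (F : Finset (Fin 3) → M) :
    ∏ S, F S = F ∅ * F {0} * F {1} * F {2} * F {0, 1} * F {0, 2} * F {1, 2} * F {0, 1, 2} := by
  have : (Finset.univ : Finset (Finset (Fin 3))) =
    {∅, {0}, {1}, {2}, {0, 1}, {0, 2}, {1, 2}, {0, 1, 2}} := by decide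
  rw [this]
  repeat rw [Finset.prod_insert (by decide)]
  rw [Finset.prod_singleton]
  simp only [mul_assoc]

/-- For two fixed directions, averaging over the base point and the third direction factors into a
square. The expectation is therefore nonnegative, which is what allows the eighth root to be undone.
-/
theorem gowersNorm_three_pow (f : Cube n → ℝ) :
    (2 ^ n) ^ 4 * gowersNorm 3 f ^ 8 = ∑ y, ∑ z, derivCorr f y z ^ 2 := by
  have h1 : (2 ^ n) ^ 4 * (𝔼 x : Cube n, 𝔼 y : Fin 3 → Cube n,
      ∏ S : Finset (Fin 3), f (x + ∑ i ∈ S, y i)) = ∑ y, ∑ z, derivCorr f y z ^ 2 := by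
    have h2 : (2 : ℝ) ^ n ≠ 0 := by positivity
    have hsq : ∀ y z, derivCorr f y z ^ 2 = ∑ x, ∑ c, (f x * f (x + y) * (f (x + z) * f (x + z + y))) *
        (f (x + c) * f (x + c + y) * (f (x + c + z) * f (x + c + z + y))) := by
      intro y z
      rw [sq, derivCorr, Finset.sum_mul]
      refine Finset.sum_congr rfl fun x _ => ?_
      rw [Finset.mul_sum, ← sum_cube_add_left _ x]
    have hc : (Fintype.card (Fin 3 → Cube n) : ℝ) = (2 ^ n) ^ 3 := by
      rw [Fintype.card_fun, Nat.cast_pow, card_cube, Fintype.card_fin]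
    simp only [Finset.expect_eq_sum_div_card, Finset.card_univ, hc, card_cube, ← Finset.sum_div, hsq]
    rw [div_div, mul_div_assoc', mul_div_right_comm,
      show (((2 : ℝ) ^ n) ^ 4 / ((2 ^ n) ^ 3 * 2 ^ n)) = 1 by field_simp, one_mul]
    simp only [sum_fin_three_fun]
    rw [Finset.sum_comm]
    refine Finset.sum_congr rfl fun y _ => ?_
    rw [Finset.sum_comm]
    refine Finset.sum_congr rfl fun z _ => Finset.sum_congr rfl fun x _ =>
      Finset.sum_congr rfl fun c _ => ?_
    rw [prod_finset_fin_three]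
    have e1 : x + c + z + y = x + y + z + c := by abel
    rw [e1, add_right_comm x z y, add_right_comm x c y, add_right_comm x c z]
    simp [← add_assoc]
    ring
  have h0 : 0 ≤ 𝔼 x : Cube n, 𝔼 y : Fin 3 → Cube n,
      ∏ S : Finset (Fin 3), f (x + ∑ i ∈ S, y i) := by
    have : (0 : ℝ) ≤ ∑ y, ∑ z, derivCorr f y z ^ 2 := by positivity
    rw [← h1] at this
    exact nonneg_of_mul_nonneg_right this (by positivity)
  rw [← h1, gowersNorm, ← Real.rpow_natCast _ 8, ← Real.rpow_mul h0]
  norm_num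

/-! ### Small doubling and Balog–Szemerédi–Gowers -/

open scoped Pointwise in
/-- A finite subset of a vector space over `𝔽₂` of small doubling spans a small subspace. -/
theorem card_span_le_of_small_difference {G : Type*} [AddCommGroup G] [Module (ZMod 2) G]
    [DecidableEq G] [Finite G] {A : Finset G} (hA : A.Nonempty) {K : ℝ} (hK : ((A - A).card : ℝ) ≤ K * A.card) :
    (Nat.card (Submodule.span (ZMod 2) (A : Set G)) : ℝ) ≤ 2 ^ (K ^ 4) * (K * A.card) := by
  classical
  have hA0 : (0 : ℝ) < A.card := by simpa using hA
  have hK0 : 0 ≤ K := by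
    by_contra! h0
    have : (0 : ℝ) ≤ (A - A).card := by positivity
    nlinarith
  have hplu : ((3 • A + A).card : ℝ) ≤ K ^ 4 * A.card := by
    have h1 := Finset.pluennecke_ruzsa_inequality_nsmul_sub hA A 4
    have h2 : ((4 • A).card : ℝ) ≤ ((A - A).card / A.card : ℝ) ^ 4 * A.card := by
      have := (NNRat.cast_le (K := ℝ)).2 h1
      push_cast at this
      exact this
    rw [← succ_nsmul]
    refine h2.trans ?_
    gcongr
    rwa [div_le_iff₀ hA0]
  obtain ⟨F, hF3, hFK, hcov⟩ := Finset.ruzsa_covering_add hA hplu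
  let T := Submodule.span (ZMod 2) (F : Set G)
  have h3 : (3 • A : Finset G) = A + A + A := by rw [succ_nsmul, two_nsmul]
  -- `T + (A - A)` is stable under adding `A`: signs do not matter over `𝔽₂`, so the sum lies in `T
  -- + 3A`, and covering gives `3A ⊆ F + (A - A)`.
  have hsub : ∀ x ∈ Submodule.span (ZMod 2) (A : Set G), ∃ t ∈ T, ∃ a ∈ A, ∃ b ∈ A, x = t + (a - b) := by
    let S : AddSubmonoid G := AddSubmonoid.closure (A : Set G)
    have hS : ∀ x ∈ S, ∃ t ∈ T, ∃ a ∈ A, ∃ b ∈ A, x = t + (a - b) := by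
      intro x hx
      induction hx using AddSubmonoid.closure_induction_right with
      | zero =>
        obtain ⟨a, ha⟩ := hA
        exact ⟨0, T.zero_mem, a, ha, a, ha, by simp⟩
      | add_right x _ y hy ih =>
        obtain ⟨t, ht, a, ha, b, hb, rfl⟩ := ih
        have hmem : a + b + y ∈ (3 • A : Finset G) := by
          rw [h3]
          exact Finset.add_mem_add (Finset.add_mem_add ha hb) hy
        obtain ⟨u, hu, v, hv, huv⟩ := Finset.mem_add.1 (hcov hmem)
        obtain ⟨c, hc, d, hd, rfl⟩ := Finset.mem_sub.1 hv
        refine ⟨t + u, T.add_mem ht (Submodule.subset_span hu), c, hc, d, hd, ?_⟩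
        rw [add_assoc t u, huv, ZModModule.sub_eq_add a b, add_assoc]
    intro x hx
    refine hS x ?_
    induction hx using Submodule.span_induction with
    | mem x h => exact AddSubmonoid.subset_closure h
    | zero => exact zero_mem _
    | add x y _ _ hx hy => exact add_mem hx hy
    | smul c x _ hx =>
      rcases (by decide : ∀ c : ZMod 2, c = 0 ∨ c = 1) c with rfl | rfl
      · rw [zero_smul]; exact zero_mem _
      · rwa [one_smul]
  have hTcard : (Nat.card T : ℝ) ≤ 2 ^ (K ^ 4) := by
    have e1 : Nat.card T = 2 ^ Module.finrank (ZMod 2) T := by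
      rw [Module.natCard_eq_pow_finrank (K := ZMod 2)]; simp
    rw [e1]
    push_cast
    rw [← Real.rpow_natCast]
    refine Real.rpow_le_rpow_of_exponent_le (by norm_num) (le_trans ?_ hFK)
    exact_mod_cast finrank_span_finset_le_card (R := ZMod 2) F
  have hcard : Nat.card (Submodule.span (ZMod 2) (A : Set G)) ≤ Nat.card (T × (A - A : Finset G)) := by
    choose! t ht a ha b hb h using hsub
    refine Nat.card_le_card_of_injective (fun x => (⟨t x, ht x x.2⟩,
      ⟨a x - b x, Finset.sub_mem_sub (ha x x.2) (hb x x.2)⟩)) ?_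
    intro x y hxy
    simp only [Prod.mk.injEq, Subtype.mk.injEq] at hxy
    ext
    rw [h x x.2, h y y.2, hxy.1, hxy.2]
  rw [Nat.card_prod, Nat.card_eq_fintype_card (α := (A - A : Finset G)), Fintype.card_coe] at hcard
  calc (Nat.card (Submodule.span (ZMod 2) (A : Set G)) : ℝ)
      ≤ Nat.card T * ((A - A).card : ℝ) := by exact_mod_cast hcard
    _ ≤ _ := by gcongr

/-- Dependent random choice followed by trimming: the Balog–Szemerédi–Gowers theorem for additive
triples. -/
theorem exists_nbhd_few_low_codegree {G : Type*} [AddCommGroup G] [DecidableEq G] {A : Finset G}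
    {k : ℝ} (hk : 0 < k) (hA : A.Nonempty)
    (h : k * (A.card : ℝ) ^ 2 ≤ (((A ×ˢ A).filter fun p => p.1 + p.2 ∈ A).card : ℝ)) :
    ∃ B ⊆ A, k ^ 2 / 2 * (A.card : ℝ) ^ 2 ≤ (B.card : ℝ) ^ 2 ∧
      (((B ×ˢ B).filter fun p => (((A.filter fun b => p.1 + b ∈ A ∧ p.2 + b ∈ A).card : ℝ) <
        k ^ 2 / 32 * A.card)).card : ℝ) ≤ (B.card : ℝ) ^ 2 / 16 := by
  classical
  set a : ℝ := (A.card : ℝ) with ha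
  have ha0 : 0 < a := by simpa [ha] using hA
  let N : G → Finset G := fun b => A.filter fun x => x + b ∈ A
  let bad : G × G → Prop := fun p => (((A.filter fun b => p.1 + b ∈ A ∧ p.2 + b ∈ A).card : ℝ) <
        k ^ 2 / 32 * a)
  have h1 : k * a ^ 2 ≤ ∑ b ∈ A, ((N b).card : ℝ) := by
    refine h.trans (le_of_eq ?_)
    rw [← Nat.cast_sum, Finset.card_filter, Finset.sum_product_right]
    congr 1
    refine Finset.sum_congr rfl fun b _ => ?_
    rw [Finset.card_filter]
  have h2 : (k * a ^ 2) ^ 2 ≤ a * ∑ b ∈ A, ((N b).card : ℝ) ^ 2 := by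
    have := sq_sum_le_card_mul_sum_sq (s := A) (f := fun b => ((N b).card : ℝ))
    refine le_trans ?_ this
    gcongr
  have h3 : ∑ b ∈ A, ((((N b) ×ˢ (N b)).filter bad).card : ℝ) ≤ k ^ 2 / 32 * a * a ^ 2 := by
    calc ∑ b ∈ A, ((((N b) ×ˢ (N b)).filter bad).card : ℝ)
        = ∑ p ∈ (A ×ˢ A).filter bad,
            ((A.filter fun b => p.1 + b ∈ A ∧ p.2 + b ∈ A).card : ℝ) := by
          rw [← Nat.cast_sum, ← Nat.cast_sum]
          congr 1
          simp_rw [Finset.card_filter _ A]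
          rw [Finset.sum_comm]
          refine Finset.sum_congr rfl fun b _ => ?_
          rw [← Finset.card_filter]
          congr 1
          ext p
          simp only [N, Finset.mem_filter, Finset.mem_product]
          tauto
      _ ≤ ∑ p ∈ (A ×ˢ A).filter bad, k ^ 2 / 32 * a :=
          Finset.sum_le_sum fun p hp => (Finset.mem_filter.1 hp).2.le
      _ ≤ ∑ p ∈ A ×ˢ A, k ^ 2 / 32 * a :=
          Finset.sum_le_sum_of_subset_of_nonneg (Finset.filter_subset _ _) fun _ _ _ => by positivity
      _ = k ^ 2 / 32 * a * a ^ 2 := by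
          rw [Finset.sum_const, Finset.card_product, nsmul_eq_mul]; push_cast; ring
  -- If every `N b` failed, summing over `b` would bound the second moment strictly by `(k²/2 + 16 ·
  -- k²/32) a³ = k² a³`, against the lower bound from Cauchy–Schwarz.
  by_contra! hcon
  have h4 : ∀ b ∈ A, ((N b).card : ℝ) ^ 2 <
      k ^ 2 / 2 * a ^ 2 + 16 * ((((N b) ×ˢ (N b)).filter bad).card : ℝ) := by
    intro b hb
    have h0 : (0 : ℝ) ≤ ((((N b) ×ˢ (N b)).filter bad).card : ℝ) := by positivity
    by_cases hb2 : k ^ 2 / 2 * a ^ 2 ≤ ((N b).card : ℝ) ^ 2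
    · have := hcon (N b) (Finset.filter_subset _ _) hb2
      have h5 : 0 < k ^ 2 / 2 * a ^ 2 := by positivity
      change _ < ((((N b) ×ˢ (N b)).filter bad).card : ℝ) at this
      linarith
    · linarith
  have h5 := Finset.sum_lt_sum_of_nonempty hA h4
  rw [Finset.sum_add_distrib, Finset.sum_const, nsmul_eq_mul, ← ha, ← Finset.mul_sum A _ (16 : ℝ)] at h5
  have h6 : a * ∑ b ∈ A, ((N b).card : ℝ) ^ 2 < a * (k ^ 2 * a ^ 3) := by
    apply mul_lt_mul_of_pos_left _ ha0
    nlinarith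
  nlinarith

-- Markov's inequality keeps the `x` with at most `|B|/4` bad partners. Two such `x`, `z` share at
-- least `|B|/2` good `y`, and each gives many representations `x - z = (x + b) - (y + b) + (y + b')
-- - (z + b')` with all four terms in `A`. Only `|A|^4` quadruples are available.
open scoped Pointwise in
theorem card_sub_le_of_few_low_codegree {G : Type*} [AddCommGroup G] [DecidableEq G] {A B : Finset G}
    {c : ℝ} (hc : 0 ≤ c)
    (h : (((B ×ˢ B).filter fun p => (((A.filter fun b => p.1 + b ∈ A ∧ p.2 + b ∈ A).card : ℝ) <
        c * A.card)).card : ℝ) ≤ (B.card : ℝ) ^ 2 / 16) :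
    ∃ D ⊆ B, 3 / 4 * (B.card : ℝ) ≤ D.card ∧
      ((D - D).card : ℝ) * (B.card / 2 * (c * A.card) ^ 2) ≤ (A.card : ℝ) ^ 4 := by
  classical
  let cod : G → G → Finset G := fun x y => A.filter fun b => x + b ∈ A ∧ y + b ∈ A
  have codcomm : ∀ x y, cod x y = cod y x := fun x y => by
    ext b; simp only [cod, Finset.mem_filter]; tauto
  let bad : G → Finset G := fun x => B.filter fun y => ((cod x y).card : ℝ) < c * A.card
  have hbad : ∑ x ∈ B, ((bad x).card : ℝ) ≤ (B.card : ℝ) ^ 2 / 16 := by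
    refine le_of_eq_of_le ?_ h
    rw [← Nat.cast_sum, Finset.card_filter, Finset.sum_product]
    congr 1
    refine Finset.sum_congr rfl fun b _ => ?_
    rw [Finset.card_filter]
  let D := B.filter fun x => ((bad x).card : ℝ) ≤ B.card / 4
  have hDB : D ⊆ B := Finset.filter_subset _ _
  refine ⟨D, hDB, ?_, ?_⟩
  · have h1 : ∑ x ∈ B \ D, (B.card / 4 : ℝ) ≤ (B.card : ℝ) ^ 2 / 16 := by
      refine le_trans ?_ hbad
      refine le_trans (Finset.sum_le_sum (g := fun x => ((bad x).card : ℝ)) ?_)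
        (Finset.sum_le_sum_of_subset_of_nonneg Finset.sdiff_subset fun _ _ _ => by positivity)
      intro x hx
      simp only [D, Finset.mem_sdiff, Finset.mem_filter, not_and, not_le] at hx
      exact (hx.2 hx.1).le
    rw [Finset.sum_const, nsmul_eq_mul] at h1
    have h2 : ((B \ D).card : ℝ) = B.card - D.card := Finset.cast_card_sdiff hDB
    rcases B.card.eq_zero_or_pos with h0 | h0
    · rw [h0]; simp
    · have h0' : (0 : ℝ) < B.card := by exact_mod_cast h0
      rw [h2] at h1
      have h3 : ((B.card : ℝ) - D.card) * B.card ≤ (B.card / 4) * B.card := by nlinarith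
      have := le_of_mul_le_mul_right h3 h0'
      linarith
  · let R : Finset (G × G × G × G) := A ×ˢ A ×ˢ A ×ˢ A
    have hR : (R.card : ℝ) = (A.card : ℝ) ^ 4 := by
      simp only [R, Finset.card_product]; push_cast; ring
    let s : G × G × G × G → G := fun r => (r.1 - r.2.1) + (r.2.2.1 - r.2.2.2)
    have key : ∀ d ∈ D - D, (B.card / 2 * (c * A.card) ^ 2 : ℝ) ≤ ((R.filter fun r => s r = d).card : ℝ) := by
      intro d hd
      obtain ⟨x, hx, z, hz, rfl⟩ := Finset.mem_sub.1 hd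
      let good := (B \ bad x) \ bad z
      have hgood : (B.card / 2 : ℝ) ≤ good.card := by
        have hx' := (Finset.mem_filter.1 hx).2
        have hz' := (Finset.mem_filter.1 hz).2
        have e1 : B.card ≤ good.card + (bad z).card + (bad x).card := by
          have i1 := Finset.le_card_sdiff (bad x) B
          have i2 := Finset.le_card_sdiff (bad z) (B \ bad x)
          simp only [good]; omega
        have e1' : (B.card : ℝ) ≤ good.card + (bad z).card + (bad x).card := by exact_mod_cast e1
        linarith
      let S : Finset (Σ _ : G, G × G) := good.sigma fun y => cod x y ×ˢ cod z y
      have hS : (B.card / 2 * (c * A.card) ^ 2 : ℝ) ≤ S.card := by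
        simp only [S, Finset.card_sigma, Finset.card_product]
        push_cast
        calc (B.card / 2 * (c * A.card) ^ 2 : ℝ) ≤ good.card * (c * A.card) ^ 2 := by gcongr
          _ = ∑ y ∈ good, (c * A.card) ^ 2 := by rw [Finset.sum_const, nsmul_eq_mul]
          _ ≤ _ := by
            refine Finset.sum_le_sum fun y hy => ?_
            simp only [good, bad, Finset.mem_sdiff, Finset.mem_filter, not_and, not_lt] at hy
            rw [sq]
            have := hy.1.2 hy.1.1
            have := hy.2 hy.1.1
            gcongr
      refine hS.trans ?_
      norm_cast
      refine Finset.card_le_card_of_injOn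
        (fun t => (x + t.2.1, t.1 + t.2.1, t.1 + t.2.2, z + t.2.2)) ?_ ?_
      · rintro ⟨y, b, b'⟩ ht
        simp only [S, cod, Finset.coe_sigma, Set.mem_sigma_iff, Finset.mem_coe, Finset.mem_product,
          Finset.mem_filter] at ht
        simp only [R, s, Finset.mem_coe, Finset.mem_filter, Finset.mem_product]
        refine ⟨⟨ht.2.1.2.1, ht.2.1.2.2, ht.2.2.2.2, ht.2.2.2.1⟩, by abel⟩
      · rintro ⟨y, b, b'⟩ - ⟨y₁, b₁, b₁'⟩ - ht
        simp only [Prod.mk.injEq, add_right_inj] at ht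
        obtain ⟨rfl, h2, -, rfl⟩ := ht
        obtain rfl := add_right_cancel h2
        rfl
    calc ((D - D).card : ℝ) * (B.card / 2 * (c * A.card) ^ 2)
        = ∑ d ∈ D - D, (B.card / 2 * (c * A.card) ^ 2 : ℝ) := by rw [Finset.sum_const, nsmul_eq_mul]
      _ ≤ ∑ d ∈ D - D, ((R.filter fun r => s r = d).card : ℝ) := Finset.sum_le_sum key
      _ ≤ R.card := by
          norm_cast
          rw [Finset.sum_card_fiberwise_eq_card_filter]
          exact Finset.card_filter_le _ _
      _ = _ := hR

open scoped Pointwise in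
/-- The Balog–Szemerédi–Gowers theorem, for a set with many additive triples. -/
theorem exists_small_difference_of_many_triples {G : Type*} [AddCommGroup G] [DecidableEq G] {A : Finset G}
    {k : ℝ} (hk : 0 < k) (hA : A.Nonempty)
    (h : k * (A.card : ℝ) ^ 2 ≤ (((A ×ˢ A).filter fun p => p.1 + p.2 ∈ A).card : ℝ)) :
    ∃ D ⊆ A, k / 4 * A.card ≤ D.card ∧ ((D - D).card : ℝ) ≤ 6000 / k ^ 6 * D.card := by
  obtain ⟨B, hBA, hB, hbad⟩ := exists_nbhd_few_low_codegree hk hA h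
  obtain ⟨D, hDB, hD, hDD⟩ := card_sub_le_of_few_low_codegree (by positivity) hbad
  have ha0 : (0 : ℝ) < A.card := by simpa using hA
  set a : ℝ := (A.card : ℝ)
  set b : ℝ := (B.card : ℝ)
  set d : ℝ := (D.card : ℝ)
  have hb0 : 0 ≤ b := by positivity
  have hb : k / 2 * a ≤ b := by
    refine abs_le_of_sq_le_sq' ?_ hb0 |>.2
    nlinarith [sq_nonneg (k * a)]
  refine ⟨D, hDB.trans hBA, by nlinarith [mul_pos hk ha0], ?_⟩
  have hbp : 0 < b := lt_of_lt_of_le (by positivity) hb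
  have hdp : 0 < d := by linarith
  have h1 : k ^ 2 * a ^ 2 * (3 / 8) ≤ d * b := by nlinarith
  rw [div_mul_eq_mul_div, le_div_iff₀ (by positivity)]
  set t : ℝ := ((D - D).card : ℝ)
  have ht : 0 ≤ t := by positivity
  have h2 : t * (b / 2 * (k ^ 4 / 1024)) ≤ a ^ 2 := by
    have : (t * (b / 2 * (k ^ 4 / 1024))) * a ^ 2 ≤ a ^ 2 * a ^ 2 := by
      calc _ = t * (b / 2 * (k ^ 2 / 32 * a) ^ 2) := by ring
        _ ≤ a ^ 4 := hDD
        _ = _ := by ring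
    exact le_of_mul_le_mul_right this (by positivity)
  -- The constant comes from `2048 · 8/3 < 6000`.
  have h3 : b * (t * k ^ 6) ≤ b * (6000 * d) := by
    calc b * (t * k ^ 6) = 2048 * k ^ 2 * (t * (b / 2 * (k ^ 4 / 1024))) := by ring
      _ ≤ 2048 * k ^ 2 * a ^ 2 := by gcongr
      _ ≤ b * (6000 * d) := by nlinarith [mul_pos hbp hdp]
  exact le_of_mul_le_mul_left h3 hbp

/-! ### Additive triples in the large spectrum -/

theorem derivFt_sq_le {f : Cube n → ℝ} (hf : IsBoolean f) (y a : Cube n) :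
    derivFt f y a ^ 2 ≤ (2 ^ n) ^ 2 := by
  rw [← sum_derivFt_sq hf y]
  exact Finset.single_le_sum (f := fun a => derivFt f y a ^ 2) (fun _ _ => sq_nonneg _)
    (Finset.mem_univ a)

/-- Cauchy–Schwarz in the form (fourth moment)² ≤ (second moment)(sixth moment); Parseval evaluates
the second moment. -/
theorem le_sum_derivFt_triples {f : Cube n → ℝ} (hf : IsBoolean f) {η : ℝ} (hη : 0 ≤ η)
    (h : η ≤ gowersNorm 3 f ^ 8) :
    η ^ 2 * (2 ^ n) ^ 8 ≤
      ∑ p : Cube n × Cube n, ∑ q : Cube n × Cube n,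
        derivFt f p.1 p.2 ^ 2 * derivFt f q.1 q.2 ^ 2 *
          derivFt f (p + q).1 (p + q).2 ^ 2 := by
  have h4 : η * (2 ^ n) ^ 5 ≤ ∑ p : Cube n × Cube n, derivFt f p.1 p.2 ^ 4 := by
    rw [Fintype.sum_prod_type, sum_derivFt_pow_four, ← gowersNorm_three_pow]
    calc η * (2 ^ n) ^ 5 = 2 ^ n * ((2 ^ n) ^ 4 * η) := by ring
      _ ≤ _ := by gcongr
  have h2 : ∑ p : Cube n × Cube n, derivFt f p.1 p.2 ^ 2 = (2 ^ n) ^ 3 := by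
    simp only [Fintype.sum_prod_type, sum_derivFt_sq hf, Finset.sum_const, nsmul_eq_mul,
      Finset.card_univ, card_cube]
    ring
  have h6 : (∑ p : Cube n × Cube n, derivFt f p.1 p.2 ^ 4) ^ 2 ≤
      (2 ^ n) ^ 3 * ∑ p : Cube n × Cube n, derivFt f p.1 p.2 ^ 6 := by
    rw [← h2]
    refine le_of_eq_of_le ?_ (le_of_le_of_eq (Finset.sum_mul_sq_le_sq_mul_sq Finset.univ
      (fun p : Cube n × Cube n => derivFt f p.1 p.2)
      (fun p : Cube n × Cube n => derivFt f p.1 p.2 ^ 3)) ?_)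
    · congr 1
      exact Finset.sum_congr rfl fun p _ => by ring
    · congr 1
      exact Finset.sum_congr rfl fun p _ => by ring
  have ht := sum_derivFt_triples f
  have hre : ∑ p : Cube n × Cube n, ∑ q : Cube n × Cube n,
        derivFt f p.1 p.2 ^ 2 * derivFt f q.1 q.2 ^ 2 * derivFt f (p + q).1 (p + q).2 ^ 2
      = 2 ^ n * ∑ p : Cube n × Cube n, derivFt f p.1 p.2 ^ 6 := by
    simp only [Fintype.sum_prod_type, ← ht, Prod.fst_add, Prod.snd_add]
    exact Finset.sum_congr rfl fun y _ => Finset.sum_comm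
  rw [hre]
  have h7 : (η * (2 ^ n) ^ 5) ^ 2 ≤ (2 ^ n) ^ 3 * ∑ p : Cube n × Cube n, derivFt f p.1 p.2 ^ 6 :=
    (pow_le_pow_left₀ (by positivity) h4 2).trans h6
  refine le_of_mul_le_mul_left (a := ((2 : ℝ) ^ n) ^ 2) ?_ (by positivity)
  calc ((2 : ℝ) ^ n) ^ 2 * (η ^ 2 * (2 ^ n) ^ 8) = (η * (2 ^ n) ^ 5) ^ 2 := by ring
    _ ≤ _ := h7
    _ = _ := by ring

/-- The frequencies at which the derivatives of `f` have a large Fourier coefficient. -/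
noncomputable def largeSpectrum (f : Cube n → ℝ) (t : ℝ) : Finset (Cube n × Cube n) :=
  Finset.univ.filter fun p => t * (2 ^ n) ^ 2 ≤ derivFt f p.1 p.2 ^ 2

theorem mem_largeSpectrum {f : Cube n → ℝ} {t : ℝ} {p : Cube n × Cube n} :
    p ∈ largeSpectrum f t ↔ t * (2 ^ n) ^ 2 ≤ derivFt f p.1 p.2 ^ 2 := by
  simp [largeSpectrum]

theorem card_largeSpectrum_fiber {f : Cube n → ℝ} (hf : IsBoolean f) (t : ℝ) (y : Cube n) :
    t * (((largeSpectrum f t).filter fun p => p.1 = y).card : ℝ) ≤ 1 := by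
  have h : (((largeSpectrum f t).filter fun p => p.1 = y).card : ℝ) * (t * (2 ^ n) ^ 2) ≤
      (2 ^ n) ^ 2 := by
    rw [← nsmul_eq_mul, ← Finset.sum_const]
    refine le_of_le_of_eq ?_ (sum_derivFt_sq hf y)
    refine (Finset.sum_le_sum (g := fun p => derivFt f y p.2 ^ 2) ?_).trans ?_
    · rintro ⟨a, b⟩ hp
      obtain ⟨hp1, rfl⟩ := Finset.mem_filter.1 hp
      exact mem_largeSpectrum.1 hp1
    · rw [← Finset.sum_image (g := Prod.snd) (f := fun a => derivFt f y a ^ 2)]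
      · exact Finset.sum_le_sum_of_subset_of_nonneg (Finset.subset_univ _) fun _ _ _ => sq_nonneg _
      · rintro ⟨a, b⟩ hp ⟨a', b'⟩ hp' h
        have h1 := (Finset.mem_filter.1 hp).2
        have h2 := (Finset.mem_filter.1 hp').2
        exact Prod.ext (h1.trans h2.symm) h
  have h0 : (0 : ℝ) < (2 ^ n) ^ 2 := by positivity
  refine le_of_mul_le_mul_right ?_ h0
  linarith

theorem card_largeSpectrum {f : Cube n → ℝ} (hf : IsBoolean f) (t : ℝ) :
    t * ((largeSpectrum f t).card : ℝ) ≤ 2 ^ n := by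
  rw [Finset.card_eq_sum_card_fiberwise (f := Prod.fst) (t := Finset.univ) (by simp), Nat.cast_sum,
    Finset.mul_sum]
  refine (Finset.sum_le_sum fun y _ => card_largeSpectrum_fiber hf t y).trans ?_
  simp [Cube]

/-- After normalisation, triples with a coefficient below the threshold in a given position
contribute at most `t`, hence the loss `3 * t` over three positions. Every other triple has weight
at most one. -/
theorem card_largeSpectrum_triples {f : Cube n → ℝ} (hf : IsBoolean f) {η t : ℝ} (hη : 0 ≤ η)
    (ht : 0 ≤ t) (h : η ≤ gowersNorm 3 f ^ 8) :
    (η ^ 2 - 3 * t) * (2 ^ n) ^ 2 ≤ (((largeSpectrum f t ×ˢ largeSpectrum f t).filter fun p =>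
      p.1 + p.2 ∈ largeSpectrum f t).card : ℝ) := by
  set A := largeSpectrum f t
  set P := (A ×ˢ A).filter fun p => p.1 + p.2 ∈ A
  let g : Cube n × Cube n → ℝ := fun p => derivFt f p.1 p.2 ^ 2
  have hg0 : ∀ p, 0 ≤ g p := fun p => sq_nonneg _
  have hg1 : ∀ p, g p ≤ (2 ^ n) ^ 2 := fun p => derivFt_sq_le hf _ _
  have hgs : ∑ p, g p = (2 ^ n) ^ 3 := by
    simp only [g, Fintype.sum_prod_type, sum_derivFt_sq hf, Finset.sum_const, nsmul_eq_mul,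
      Finset.card_univ, card_cube]
    ring
  have hgA : ∀ p, p ∉ A → g p ≤ t * (2 ^ n) ^ 2 := fun p hp => by
    rw [mem_largeSpectrum, not_le] at hp; exact hp.le
  have hpt : ∀ p q : Cube n × Cube n, g p * g q * g (p + q) ≤
      (if (p, q) ∈ P then ((2 ^ n) ^ 2) ^ 3 else 0) +
        t * (2 ^ n) ^ 2 * (g p * g q + g p * g (p + q) + g q * g (p + q)) := by
    intro p q
    have i1 : 0 ≤ g p * g q := mul_nonneg (hg0 _) (hg0 _)
    have i2 : 0 ≤ g p * g (p + q) := mul_nonneg (hg0 _) (hg0 _)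
    have i3 : 0 ≤ g q * g (p + q) := mul_nonneg (hg0 _) (hg0 _)
    have i4 : 0 ≤ t * (2 ^ n) ^ 2 := by positivity
    split_ifs with hP
    · have : g p * g q * g (p + q) ≤ (2 ^ n) ^ 2 * (2 ^ n) ^ 2 * (2 ^ n) ^ 2 := by
        gcongr <;> first | apply hg0 | apply hg1
      have : 0 ≤ t * (2 ^ n) ^ 2 * (g p * g q + g p * g (p + q) + g q * g (p + q)) := by positivity
      linarith
    · rw [zero_add]
      simp only [P, Finset.mem_filter, Finset.mem_product] at hP
      by_cases hp : p ∈ A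
      · by_cases hq : q ∈ A
        · have hpq : p + q ∉ A := fun h => hP ⟨⟨hp, hq⟩, h⟩
          nlinarith [mul_le_mul_of_nonneg_left (hgA _ hpq) i1, mul_nonneg i4 i2, mul_nonneg i4 i3]
        · nlinarith [mul_le_mul_of_nonneg_left (hgA _ hq) i2, mul_nonneg i4 i1, mul_nonneg i4 i3]
      · nlinarith [mul_le_mul_of_nonneg_left (hgA _ hp) i3, mul_nonneg i4 i1, mul_nonneg i4 i2]
  have hsum := (le_sum_derivFt_triples hf hη h).trans
    (Finset.sum_le_sum fun p _ => Finset.sum_le_sum fun q _ => hpt p q)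
  have s1 : ∑ p, ∑ q, g p * g q = ((2 ^ n) ^ 3) ^ 2 := by
    rw [← Finset.sum_mul_sum, hgs, sq]
  have s2 : ∑ p, ∑ q, g p * g (p + q) = ((2 ^ n) ^ 3) ^ 2 := by
    rw [← s1]
    simp only [← Finset.mul_sum]
    exact Finset.sum_congr rfl fun p _ => by rw [← Equiv.sum_comp (Equiv.addLeft p) g]; rfl
  have s3 : ∑ p, ∑ q, g q * g (p + q) = ((2 ^ n) ^ 3) ^ 2 := by
    rw [Finset.sum_comm, ← s2]
    simp only [add_comm]
  have s4 : ∑ p, ∑ q, (if (p, q) ∈ P then (((2 : ℝ) ^ n) ^ 2) ^ 3 else 0) =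
      P.card * ((2 ^ n) ^ 2) ^ 3 := by
    rw [← Fintype.sum_prod_type', ← Finset.sum_filter, Finset.sum_const, nsmul_eq_mul]
    simp
  have s5 : ∑ p, ∑ q, (g p * g q + g p * g (p + q) + g q * g (p + q)) = 3 * ((2 ^ n) ^ 3) ^ 2 := by
    simp only [Finset.sum_add_distrib]
    rw [s1, s2, s3]; ring
  have s6 : ∑ p, ∑ q, ((if (p, q) ∈ P then (((2 : ℝ) ^ n) ^ 2) ^ 3 else 0) +
        t * (2 ^ n) ^ 2 * (g p * g q + g p * g (p + q) + g q * g (p + q))) =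
      P.card * ((2 ^ n) ^ 2) ^ 3 + t * (2 ^ n) ^ 2 * (3 * ((2 ^ n) ^ 3) ^ 2) := by
    rw [← s4, ← s5, Finset.mul_sum, ← Finset.sum_add_distrib]
    refine Finset.sum_congr rfl fun p _ => ?_
    rw [Finset.mul_sum, ← Finset.sum_add_distrib]
  rw [s6] at hsum
  refine le_of_mul_le_mul_right (a := (((2 : ℝ) ^ n) ^ 2) ^ 3) ?_ (by positivity)
  nlinarith

/-! ### Extracting an affine map -/

/-- A linear section of the first projection of `H = span D` extends to `L`, and `H` splits into
translates of the graph of `L` by vertical vectors `w ∈ W`. Some translate holds at least `|D|/|W|`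
points of `D`, while `|W|` is controlled by `|W| |Y| ≤ |H|` and `t |D| ≤ |Y|`. -/
theorem exists_affine_section {D : Finset (Cube n × Cube n)} {t : ℝ}
    (hD : ∀ y, t * ((D.filter fun p => p.1 = y).card : ℝ) ≤ 1) :
    ∃ (L : Cube n →ₗ[ZMod 2] Cube n) (w : Cube n), t * (D.card : ℝ) ^ 2 ≤
      ((Finset.univ.filter fun y => (y, L y + w) ∈ D).card : ℝ) *
        Nat.card (Submodule.span (ZMod 2) (D : Set (Cube n × Cube n))) := by
  classical
  set H := Submodule.span (ZMod 2) (D : Set (Cube n × Cube n))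
  have hDH : ∀ p ∈ D, p ∈ H := fun p hp => Submodule.subset_span hp
  let π : H →ₗ[ZMod 2] Cube n := LinearMap.fst _ _ _ ∘ₗ H.subtype
  obtain ⟨σ, hσ⟩ := π.rangeRestrict.exists_rightInverse_of_surjective π.range_rangeRestrict
  obtain ⟨s, hs⟩ := LinearMap.exists_extend σ
  let L : Cube n →ₗ[ZMod 2] Cube n := LinearMap.snd _ _ _ ∘ₗ H.subtype ∘ₗ s
  have hL : ∀ p ∈ H, (p.1, L p.1) ∈ H := by
    intro p hp
    have h1 : p.1 ∈ LinearMap.range π := ⟨⟨p, hp⟩, rfl⟩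
    have h2 : s p.1 = σ ⟨p.1, h1⟩ := LinearMap.congr_fun hs ⟨p.1, h1⟩
    have h3 : (s p.1 : Cube n × Cube n).1 = p.1 := by
      rw [h2]
      exact congrArg Subtype.val (LinearMap.congr_fun hσ ⟨p.1, h1⟩)
    have h4 : ((p.1, L p.1) : Cube n × Cube n) = s p.1 := Prod.ext h3.symm rfl
    rw [h4]
    exact (s p.1).2
  let W : Finset (Cube n) := Finset.univ.filter fun w => ((0, w) : Cube n × Cube n) ∈ H
  have hW : ∀ p ∈ D, p.2 - L p.1 ∈ W := by
    intro p hp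
    have := H.sub_mem (hDH p hp) (hL p (hDH p hp))
    have e : p - (p.1, L p.1) = (0, p.2 - L p.1) := Prod.ext (sub_self _) rfl
    rw [e] at this
    exact Finset.mem_filter.2 ⟨Finset.mem_univ _, this⟩
  have hW0 : W.Nonempty := ⟨0, Finset.mem_filter.2 ⟨Finset.mem_univ _, H.zero_mem⟩⟩
  let Y := D.image Prod.fst
  have hY : t * (D.card : ℝ) ≤ Y.card := by
    rw [Finset.card_eq_sum_card_image Prod.fst D, Nat.cast_sum, Finset.mul_sum]
    refine (Finset.sum_le_sum fun y _ => hD y).trans ?_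
    simp [Y]
  have hWH : W.card * Y.card ≤ Nat.card H := by
    rw [← Finset.card_product, ← Fintype.card_coe, ← Nat.card_eq_fintype_card]
    refine Nat.card_le_card_of_injective
      (fun q => (⟨(q.1.2, L q.1.2 + q.1.1), ?_⟩ : H)) ?_
    · obtain ⟨⟨w, y⟩, hq⟩ := q
      obtain ⟨hw, hy⟩ := Finset.mem_product.1 hq
      obtain ⟨p, hp, rfl⟩ := Finset.mem_image.1 hy
      have := H.add_mem (hL p (hDH p hp)) (Finset.mem_filter.1 hw).2
      simpa using this
    · rintro ⟨⟨w, y⟩, hq⟩ ⟨⟨w', y'⟩, hq'⟩ h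
      simp only [Subtype.mk.injEq, Prod.mk.injEq] at h
      obtain ⟨rfl, h⟩ := h
      obtain rfl := add_left_cancel h
      rfl
  obtain ⟨w, -, hw⟩ : ∃ w ∈ W, (D.card : ℝ) / W.card ≤
      ((D.filter fun p => p.2 - L p.1 = w).card : ℝ) := by
    refine Finset.exists_le_of_sum_le hW0 ?_
    rw [Finset.sum_const, nsmul_eq_mul, mul_div_cancel₀ _ (by exact_mod_cast hW0.card_ne_zero)]
    have := Finset.card_eq_sum_card_fiberwise (s := D) (t := W)
      (f := fun p : Cube n × Cube n => p.2 - L p.1) (fun p hp => hW p hp)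
    rw [this, Nat.cast_sum]
  refine ⟨L, w, ?_⟩
  have hM : (D.filter fun p => p.2 - L p.1 = w).card ≤
      (Finset.univ.filter fun y => (y, L y + w) ∈ D).card := by
    refine Finset.card_le_card_of_injOn Prod.fst ?_ ?_
    · rintro ⟨y, a⟩ hp
      obtain ⟨hp, h⟩ := Finset.mem_filter.1 hp
      have : L y + w = a := by rw [← h]; simp
      simpa [this] using hp
    · rintro ⟨y, a⟩ hp ⟨y', a'⟩ hp' (rfl : y = y')
      have h1 := (Finset.mem_filter.1 hp).2
      have h2 := (Finset.mem_filter.1 hp').2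
      exact Prod.ext rfl (sub_left_injective (h1.trans h2.symm))
  set M : ℝ := ((Finset.univ.filter fun y => (y, L y + w) ∈ D).card : ℝ)
  have hWp : (0 : ℝ) < W.card := by simpa using hW0
  have hDM : (D.card : ℝ) ≤ M * W.card := by
    rw [← div_le_iff₀ hWp]
    exact hw.trans (by simp only [M]; exact_mod_cast hM)
  have hWH' : (W.card : ℝ) * Y.card ≤ Nat.card H := by exact_mod_cast hWH
  have hM0 : 0 ≤ M := by positivity
  calc t * (D.card : ℝ) ^ 2 = (t * D.card) * D.card := by ring
    _ ≤ Y.card * (M * W.card) := by gcongr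
    _ = M * (W.card * Y.card) := by ring
    _ ≤ _ := by gcongr

/-! ### Near-symmetry of the affine map -/

/-- The radical of the alternating form `(x, y) ↦ L x ⬝ y + L y ⬝ x`. -/
def symmKernel (L : Cube n →ₗ[ZMod 2] Cube n) : Submodule (ZMod 2) (Cube n) where
  carrier := {x | ∀ y, L x ⬝ᵥ y + L y ⬝ᵥ x = 0}
  zero_mem' := by simp
  add_mem' := by
    intro a b ha hb y
    simp only [map_add, add_dotProduct, dotProduct_add]
    linear_combination ha y + hb y
  smul_mem' := by
    intro c a ha y
    simp only [map_smul, smul_dotProduct, dotProduct_smul, ← smul_add, ha y, smul_zero]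

theorem sum_sgn_symm (L : Cube n →ₗ[ZMod 2] Cube n) (x : Cube n) [Decidable (x ∈ symmKernel L)] :
    ∑ b, sgn (L x ⬝ᵥ b + L b ⬝ᵥ x) = if x ∈ symmKernel L then 2 ^ n else 0 := by
  let l : Cube n →+ ZMod 2 := AddMonoidHom.mk' (fun b => L x ⬝ᵥ b + L b ⬝ᵥ x) (fun a b => by
    simp only [map_add, add_dotProduct, dotProduct_add]; ring)
  have : l = 0 ↔ x ∈ symmKernel L := by
    constructor
    · intro h b
      exact DFunLike.congr_fun h b
    · intro h
      exact AddMonoidHom.ext fun b => h b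
  rw [← if_congr this rfl rfl]
  exact sum_sgn_linear l

/-- Cauchy–Schwarz in `b` discards `u b`. In the expanded square, the character sum over `b`
vanishes unless `x + y` lies in the radical. -/
theorem sum_sum_sgn_symm_sq_le (L : Cube n →ₗ[ZMod 2] Cube n) (u : Cube n → ℝ) (hu : ∀ x, |u x| ≤ 1) :
    (∑ b, ∑ x, u b * u x * sgn (L x ⬝ᵥ b + L b ⬝ᵥ x)) ^ 2 ≤
      (2 ^ n) ^ 3 * Nat.card (symmKernel L) := by
  classical
  let v : Cube n → ℝ := fun b => ∑ x, u x * sgn (L x ⬝ᵥ b + L b ⬝ᵥ x)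
  have h1 : ∑ b, ∑ x, u b * u x * sgn (L x ⬝ᵥ b + L b ⬝ᵥ x) = ∑ b, u b * v b := by
    simp only [v, Finset.mul_sum, mul_assoc]
  have hu2 : ∑ b, u b ^ 2 ≤ 2 ^ n := by
    refine (Finset.sum_le_sum fun b _ => (sq_le_one_iff_abs_le_one _).2 (hu b)).trans ?_
    simp
  have hv : ∑ b, v b ^ 2 ≤ (2 ^ n) ^ 2 * Nat.card (symmKernel L) := by
    have hcard : ∀ x : Cube n, ∑ y, (if x + y ∈ symmKernel L then (1 : ℝ) else 0) =
        Nat.card (symmKernel L) := by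
      intro x
      rw [sum_cube_add_left (fun y => if y ∈ symmKernel L then (1 : ℝ) else 0) x, Finset.sum_boole,
        Nat.card_eq_fintype_card, Fintype.card_subtype]
    calc ∑ b, v b ^ 2 = ∑ x, ∑ y, u x * u y * ∑ b, sgn (L (x + y) ⬝ᵥ b + L b ⬝ᵥ (x + y)) := by
          simp only [v, sq, Finset.sum_mul_sum]
          simp only [Finset.mul_sum]
          rw [Finset.sum_comm]
          refine Finset.sum_congr rfl fun x _ => ?_
          rw [Finset.sum_comm]
          refine Finset.sum_congr rfl fun y _ => Finset.sum_congr rfl fun b _ => ?_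
          rw [show L (x + y) ⬝ᵥ b + L b ⬝ᵥ (x + y) =
            (L x ⬝ᵥ b + L b ⬝ᵥ x) + (L y ⬝ᵥ b + L b ⬝ᵥ y) by
              simp only [map_add, add_dotProduct, dotProduct_add]; ring, sgn_add (L x ⬝ᵥ b + _)]
          ring
      _ ≤ ∑ x : Cube n, ∑ y, 2 ^ n * (if x + y ∈ symmKernel L then (1 : ℝ) else 0) := by
          refine Finset.sum_le_sum fun x _ => Finset.sum_le_sum fun y _ => ?_
          rw [sum_sgn_symm]
          have : u x * u y ≤ 1 := by
            refine (le_abs_self _).trans ?_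
            rw [abs_mul]
            exact mul_le_one₀ (hu x) (abs_nonneg _) (hu y)
          split_ifs
          · nlinarith [show (0 : ℝ) < 2 ^ n by positivity]
          · simp
      _ = _ := by
          simp only [← Finset.mul_sum, hcard, Finset.sum_const, nsmul_eq_mul, Finset.card_univ,
            card_cube]
          ring
  rw [h1]
  calc (∑ b, u b * v b) ^ 2 ≤ (∑ b, u b ^ 2) * ∑ b, v b ^ 2 := Finset.sum_mul_sq_le_sq_mul_sq _ _ _
    _ ≤ 2 ^ n * ((2 ^ n) ^ 2 * Nat.card (symmKernel L)) := by gcongr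
    _ = _ := by ring

theorem IsBoolean.abs_eq_one {f : Cube n → ℝ} (hf : IsBoolean f) (x : Cube n) : |f x| = 1 := by
  rcases hf x with h | h <;> simp [h]

/-- An affine map that predicts large Fourier coefficients of the derivatives of `f` is nearly
symmetric. -/
theorem le_card_symmKernel {f : Cube n → ℝ} (hf : IsBoolean f) (L : Cube n →ₗ[ZMod 2] Cube n)
    (w : Cube n) {c : ℝ} (hc : 0 ≤ c) (h : c * (2 ^ n) ^ 3 ≤ ∑ y, derivFt f y (L y + w) ^ 2) :
    c ^ 2 * 2 ^ n ≤ Nat.card (symmKernel L) := by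
  -- With `s = y + z` fixed and `b = x + y`, the product of values of `f` and the phase both
  -- separate into a factor in `x`, a factor in `b`, the sign of `w ⬝ᵥ s` and the symmetric cross
  -- term.
  let u : Cube n → Cube n → ℝ := fun s x => f x * f (x + s) * sgn (L x ⬝ᵥ x + L x ⬝ᵥ s + w ⬝ᵥ x)
  have hu : ∀ s x, |u s x| ≤ 1 := fun s x => by
    simp only [u, abs_mul, hf.abs_eq_one, abs_sgn, mul_one, le_refl]
  let I : Cube n → ℝ := fun s => ∑ b, ∑ x, u s b * u s x * sgn (L x ⬝ᵥ b + L b ⬝ᵥ x)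
  have hX : ∑ y, derivFt f y (L y + w) ^ 2 = ∑ s, sgn (w ⬝ᵥ s) * I s := by
    simp only [derivFt_sq, ft, derivCorr, I, Finset.mul_sum, Finset.sum_mul]
    have e1 : ∀ y : Cube n, ∑ z, ∑ x, f x * f (x + y) * (f (x + z) * f (x + z + y)) *
        sgn ((L y + w) ⬝ᵥ z) = ∑ x, ∑ s, f x * f (x + y) * (f (x + y + s) * f (x + s)) *
          sgn ((L y + w) ⬝ᵥ (y + s)) := by
      intro y
      rw [Finset.sum_comm]
      refine Finset.sum_congr rfl fun x _ => ?_
      rw [← sum_cube_add_left _ y]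
      refine Finset.sum_congr rfl fun s _ => ?_
      rw [← add_assoc x y s, add_right_comm x y s, Cube.add_add_cancel]
    simp only [e1]
    rw [Finset.sum_comm]
    have e2 : ∀ x : Cube n, ∑ y, ∑ s, f x * f (x + y) * (f (x + y + s) * f (x + s)) *
          sgn ((L y + w) ⬝ᵥ (y + s)) = ∑ b, ∑ s, f x * f b * (f (b + s) * f (x + s)) *
          sgn ((L (x + b) + w) ⬝ᵥ (x + b + s)) := by
      intro x
      rw [← sum_cube_add_left _ x]
      refine Finset.sum_congr rfl fun b _ => ?_
      rw [← add_assoc x x b, ZModModule.add_self, zero_add]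
    simp only [e2]
    rw [Finset.sum_congr rfl fun x _ => Finset.sum_comm, Finset.sum_comm]
    refine Finset.sum_congr rfl fun s _ => ?_
    rw [Finset.sum_comm]
    refine Finset.sum_congr rfl fun b _ => Finset.sum_congr rfl fun x _ => ?_
    have : (L (x + b) + w) ⬝ᵥ (x + b + s) = w ⬝ᵥ s + ((L b ⬝ᵥ b + L b ⬝ᵥ s + w ⬝ᵥ b) +
        (L x ⬝ᵥ x + L x ⬝ᵥ s + w ⬝ᵥ x) + (L x ⬝ᵥ b + L b ⬝ᵥ x)) := by
      simp only [map_add, add_dotProduct, dotProduct_add]; ring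
    rw [this]
    simp only [sgn_add, u]
    ring
  have hX2 : (∑ y, derivFt f y (L y + w) ^ 2) ^ 2 ≤
      (2 ^ n) ^ 5 * Nat.card (symmKernel L) := by
    rw [hX]
    calc _ ≤ (∑ s, sgn (w ⬝ᵥ s) ^ 2) * ∑ s, I s ^ 2 := Finset.sum_mul_sq_le_sq_mul_sq _ _ _
      _ ≤ 2 ^ n * ∑ s : Cube n, (2 ^ n) ^ 3 * (Nat.card (symmKernel L) : ℝ) := by
          gcongr with s
          · simp
          · exact sum_sum_sgn_symm_sq_le L (u s) (hu s)
      _ = _ := by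
          rw [Finset.sum_const, nsmul_eq_mul, Finset.card_univ, card_cube]; ring
  have h2 := (pow_le_pow_left₀ (by positivity) h 2).trans hX2
  refine le_of_mul_le_mul_left (a := ((2 : ℝ) ^ n) ^ 5) ?_ (by positivity)
  refine le_of_eq_of_le ?_ h2
  ring

/-- The symmetric kernel contains a subspace of index at most two on which `x ↦ L x ⬝ x` vanishes. -/
theorem exists_isotropic (L : Cube n →ₗ[ZMod 2] Cube n) :
    ∃ K : Submodule (ZMod 2) (Cube n), (∀ x ∈ K, L x ⬝ᵥ x = 0) ∧
      Nat.card (symmKernel L) ≤ 2 * Nat.card K := by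
  -- The diagonal form is additive here because its cross terms vanish on the radical.
  let φ : symmKernel L →+ ZMod 2 := AddMonoidHom.mk' (fun x => L x ⬝ᵥ (x : Cube n)) (by
    rintro ⟨x, hx⟩ ⟨y, hy⟩
    simp only [Submodule.coe_add, map_add, add_dotProduct, dotProduct_add]
    linear_combination hx y)
  let φ' : symmKernel L →ₗ[ZMod 2] ZMod 2 := φ.toZModLinearMap 2
  refine ⟨(LinearMap.ker φ').map (symmKernel L).subtype, ?_, ?_⟩
  · rintro _ ⟨x, hx, rfl⟩
    exact hx
  · have h1 : Nat.card ((LinearMap.ker φ').map (symmKernel L).subtype) = Nat.card (LinearMap.ker φ') :=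
      Nat.card_congr (Submodule.equivMapOfInjective _ (symmKernel L).injective_subtype _).symm.toEquiv
    rw [h1, Module.natCard_eq_pow_finrank (K := ZMod 2) (V := symmKernel L),
      Module.natCard_eq_pow_finrank (K := ZMod 2) (V := LinearMap.ker φ'),
      ← LinearMap.finrank_range_add_finrank_ker φ', pow_add]
    refine Nat.mul_le_mul_right _ ?_
    have : Module.finrank (ZMod 2) (LinearMap.range φ') ≤ 1 := by
      simpa using Submodule.finrank_le (LinearMap.range φ')
    calc _ ≤ Nat.card (ZMod 2) ^ 1 := Nat.pow_le_pow_right (by simp) this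
      _ = 2 := by simp

/-! ### Integration to a quadratic polynomial -/

/-- Every alternating form over `𝔽₂` is the polarisation of a quadratic polynomial. -/
theorem exists_polynomial_of_alternating (B : Cube n →ₗ[ZMod 2] Cube n →ₗ[ZMod 2] ZMod 2)
    (hB : ∀ x, B x x = 0) :
    ∃ P : MvPolynomial (Fin n) (ZMod 2), P.totalDegree ≤ 2 ∧ ∀ x y : Cube n,
      MvPolynomial.eval (x + y) P = MvPolynomial.eval x P + MvPolynomial.eval y P + B x y := by
  let β : Fin n → Fin n → ZMod 2 := fun i j => B (Pi.single i 1) (Pi.single j 1)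
  have hβ0 : ∀ i, β i i = 0 := fun i => hB _
  have hβs : ∀ i j, β j i = β i j := by
    intro i j
    have h := hB (Pi.single i 1 + Pi.single j 1)
    simp only [map_add, LinearMap.add_apply, hB, zero_add, add_zero] at h
    change β j i + β i j = 0 at h
    rwa [← ZModModule.sub_eq_add, sub_eq_zero] at h
  have hBx : ∀ x y, B x y = ∑ i, ∑ j, x i * y j * β i j := by
    intro x y
    conv_lhs => rw [← Finset.univ_sum_single x, ← Finset.univ_sum_single y]
    simp only [map_sum, LinearMap.sum_apply]
    rw [Finset.sum_comm]
    refine Finset.sum_congr rfl fun i _ => Finset.sum_congr rfl fun j _ => ?_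
    have h1 : ∀ (i : Fin n) (c : ZMod 2), (Pi.single i c : Cube n) = c • Pi.single i 1 := by
      intro i c
      rw [← Pi.single_smul]; simp
    rw [h1 i, h1 j, map_smul, map_smul, LinearMap.smul_apply, smul_eq_mul, smul_eq_mul]
    simp only [β]; ring
  -- Halving is impossible in characteristic two; the strictly upper triangular part serves instead,
  -- since the diagonal of `β` is zero.
  refine ⟨∑ i, ∑ j, if i < j then MvPolynomial.C (β i j) * MvPolynomial.X i * MvPolynomial.X j else 0,
    ?_, ?_⟩
  · refine MvPolynomial.totalDegree_finsetSum_le fun i _ => MvPolynomial.totalDegree_finsetSum_le fun j _ => ?_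
    split_ifs
    · refine (MvPolynomial.totalDegree_mul _ _).trans ?_
      refine (add_le_add (MvPolynomial.totalDegree_mul _ _) le_rfl).trans ?_
      simp
    · simp
  · intro x y
    have hsplit : B x y = ∑ i, ∑ j, if i < j then (x i * y j + x j * y i) * β i j else 0 := by
      have h1 : ∀ i j, x i * y j * β i j = (if i < j then x i * y j * β i j else 0) +
          (if j < i then x i * y j * β i j else 0) := by
        intro i j
        rcases lt_trichotomy i j with h | rfl | h
        · simp [h, h.not_gt]
        · simp [hβ0]
        · simp [h, h.not_gt]
      rw [hBx]
      rw [Finset.sum_congr rfl fun i _ => Finset.sum_congr rfl fun j _ => h1 i j]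
      simp only [Finset.sum_add_distrib]
      conv_lhs => rw [add_comm, Finset.sum_comm, add_comm]
      rw [← Finset.sum_add_distrib]
      refine Finset.sum_congr rfl fun i _ => ?_
      rw [← Finset.sum_add_distrib]
      refine Finset.sum_congr rfl fun j _ => ?_
      split_ifs
      · rw [hβs]; ring
      · simp
    rw [hsplit]
    simp only [map_sum, ← Finset.sum_add_distrib]
    refine Finset.sum_congr rfl fun i _ => Finset.sum_congr rfl fun j _ => ?_
    split_ifs
    · simp only [map_mul, MvPolynomial.eval_C, MvPolynomial.eval_X, Pi.add_apply]; ring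
    · simp

theorem ft_derivFt (h : Cube n → ℝ) (m a : Cube n) :
    ft (fun y => derivFt h y m) a = ft h a * ft h (a + m) := by
  simp only [ft, derivFt, Finset.sum_mul_sum]
  simp only [Finset.sum_mul]
  rw [Finset.sum_comm]
  conv_rhs => rw [Finset.sum_comm]
  refine Finset.sum_congr rfl fun x _ => ?_
  rw [← sum_cube_add_left (fun y => h y * _ * _) x]
  refine Finset.sum_congr rfl fun y _ => ?_
  rw [add_dotProduct, dotProduct_add, sgn_add, sgn_add]
  linear_combination - h x * h (x + y) * sgn (m ⬝ᵥ x) * sgn (a ⬝ᵥ y) * sgn_mul_self (a ⬝ᵥ x)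

/-- By Parseval in the direction, the left side is the average over `b` of `ft h b ^ 2 * ft h (b +
m) ^ 2`. Bounding the second factor by the maximum lets one `a` serve every `m`. -/
theorem exists_sum_derivFt_sq_le {h : Cube n → ℝ} (hh : IsBoolean h) :
    ∃ a, ∀ m, ∑ y, derivFt h y m ^ 2 ≤ 2 ^ n * ft h a ^ 2 := by
  obtain ⟨a, -, ha⟩ := Finset.exists_max_image Finset.univ (fun a : Cube n => ft h a ^ 2)
    Finset.univ_nonempty
  refine ⟨a, fun m => ?_⟩
  have hs : ∑ b, ft h b ^ 2 = (2 ^ n) ^ 2 := by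
    rw [sum_ft_sq]
    simp only [hh.sq_eq_one]
    simp [sq]
  have h1 := sum_ft_sq (fun y => derivFt h y m)
  simp only [ft_derivFt, mul_pow] at h1
  refine le_of_mul_le_mul_left (a := (2 : ℝ) ^ n) ?_ (by positivity)
  rw [← h1]
  calc ∑ b, ft h b ^ 2 * ft h (b + m) ^ 2 ≤ ∑ b, ft h b ^ 2 * ft h a ^ 2 := by
        refine Finset.sum_le_sum fun b _ => ?_
        have := ha (b + m) (Finset.mem_univ _)
        gcongr
    _ = 2 ^ n * (2 ^ n * ft h a ^ 2) := by rw [← Finset.sum_mul, hs]; ring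

/-- The quadratic form attached to a large isotropic subspace correlates with `f`. -/
theorem exists_quadratic_correlation {f : Cube n → ℝ} (hf : IsBoolean f)
    (L : Cube n →ₗ[ZMod 2] Cube n) (w : Cube n) {c : ℝ} (hc : 0 ≤ c)
    (h : c * (2 ^ n) ^ 3 ≤ ∑ y, derivFt f y (L y + w) ^ 2) :
    ∃ (P : MvPolynomial (Fin n) (ZMod 2)) (a : Cube n), P.totalDegree ≤ 2 ∧
      c ^ 3 / 2 * (2 ^ n) ^ 2 ≤ ft (fun x => f x * sgn (MvPolynomial.eval x P)) a ^ 2 := by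
  classical
  obtain ⟨K, hK, hKcard⟩ := exists_isotropic L
  have hKc : c ^ 2 * 2 ^ n ≤ 2 * (Nat.card K : ℝ) :=
    (le_card_symmKernel hf L w hc h).trans (by exact_mod_cast hKcard)
  obtain ⟨π, hπ⟩ := K.subtype.exists_leftInverse_of_injective (by simp)
  let p : Cube n →ₗ[ZMod 2] Cube n := K.subtype ∘ₗ π
  have hpK : ∀ x, p x ∈ K := fun x => (π x).2
  have hp : ∀ x ∈ K, p x = x := fun x hx =>
    congrArg Subtype.val (LinearMap.congr_fun hπ ⟨x, hx⟩)
  -- With `p` a projection onto `K`, this form equals `L x ⬝ᵥ y` for `x ∈ K`. It is alternating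
  -- because `L (p x) ⬝ᵥ p x = 0`.
  let B : Cube n →ₗ[ZMod 2] Cube n →ₗ[ZMod 2] ZMod 2 :=
    LinearMap.mk₂ (ZMod 2) (fun x y => L (p x) ⬝ᵥ y + L (p y) ⬝ᵥ (x - p x))
      (fun x x' y => by
        simp only [map_add, add_dotProduct, dotProduct_add, dotProduct_sub]; ring)
      (fun c x y => by
        simp only [map_smul, smul_dotProduct, dotProduct_smul, dotProduct_sub, smul_eq_mul]; ring)
      (fun x y y' => by
        simp only [map_add, add_dotProduct, dotProduct_add, dotProduct_sub]; ring)
      (fun c x y => by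
        simp only [map_smul, smul_dotProduct, dotProduct_smul, dotProduct_sub, smul_eq_mul]; ring)
  have hB : ∀ x y, B x y = L (p x) ⬝ᵥ y + L (p y) ⬝ᵥ (x - p x) := fun x y => rfl
  obtain ⟨P, hPdeg, hP⟩ := exists_polynomial_of_alternating B (fun x => by
    rw [hB, dotProduct_sub, hK _ (hpK x), sub_zero, ZModModule.add_self])
  let q : Cube n → ℝ := fun x => sgn (MvPolynomial.eval x P)
  let g : Cube n → ℝ := fun x => f x * q x
  have hg : IsBoolean g := fun x => by
    have : g x ^ 2 = 1 := by simp only [g, q, mul_pow, hf.sq_eq_one, sgn_sq, one_mul]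
    exact (mul_self_eq_one_iff.1 (by rwa [← sq])).symm
  obtain ⟨a, ha⟩ := exists_sum_derivFt_sq_le hg
  refine ⟨P, a, hPdeg, ?_⟩
  -- Averaging over translates: some coset of `K` carries its fair share of the mass.
  have hcoset : ∃ y₀, (Nat.card K : ℝ) * (c * (2 ^ n) ^ 2) ≤
      ∑ y, if y + y₀ ∈ K then derivFt f y (L y + w) ^ 2 else 0 := by
    obtain ⟨y₀, -, hy₀⟩ : ∃ y₀ ∈ (Finset.univ : Finset (Cube n)),
        (Nat.card K : ℝ) * (c * (2 ^ n) ^ 2) ≤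
          ∑ y, if y + y₀ ∈ K then derivFt f y (L y + w) ^ 2 else 0 := by
      refine Finset.exists_le_of_sum_le Finset.univ_nonempty ?_
      rw [Finset.sum_comm]
      have : ∀ y : Cube n, (∑ y₀, if y + y₀ ∈ K then derivFt f y (L y + w) ^ 2 else 0) =
          Nat.card K * derivFt f y (L y + w) ^ 2 := by
        intro y
        rw [sum_cube_add_left (fun z => if z ∈ K then derivFt f y (L y + w) ^ 2 else 0) y,
          ← Finset.sum_filter, Finset.sum_const, nsmul_eq_mul, Nat.card_eq_fintype_card,
          Fintype.card_subtype]
      rw [Finset.sum_congr rfl fun y _ => this y, Finset.sum_const, nsmul_eq_mul,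
        Finset.card_univ, card_cube, ← Finset.mul_sum]
      calc (2 : ℝ) ^ n * (Nat.card K * (c * (2 ^ n) ^ 2)) = Nat.card K * (c * (2 ^ n) ^ 3) := by ring
        _ ≤ _ := by gcongr
    exact ⟨y₀, hy₀⟩
  obtain ⟨y₀, hy₀⟩ := hcoset
  -- On the coset of `y₀`, the predicted frequency `L y + w` and the functional `B y` differ by this
  -- one vector, independent of `y`.
  let m : Cube n := L y₀ + w + fun i => B y₀ (Pi.single i 1)
  have hBm : ∀ x, B y₀ x = (fun i => B y₀ (Pi.single i 1)) ⬝ᵥ x := by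
    intro x
    rw [LinearMap.pi_apply_eq_sum_univ (B y₀) x]
    simp only [dotProduct, smul_eq_mul]
    refine Finset.sum_congr rfl fun i _ => ?_
    rw [mul_comm]
    congr 2
    ext j
    simp [Pi.single_apply, eq_comm]
  have hlin : ∀ y, y + y₀ ∈ K → ∀ x, (L y + w) ⬝ᵥ x = B y x + m ⬝ᵥ x := by
    intro y hy x
    have h1 : B (y + y₀) x = L (y + y₀) ⬝ᵥ x := by
      rw [hB, hp _ hy, sub_self, dotProduct_zero, add_zero]
    simp only [map_add, LinearMap.add_apply, add_dotProduct] at h1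
    simp only [m, add_dotProduct, ← hBm]
    have h2 := ZModModule.add_self (L y₀ ⬝ᵥ x)
    linear_combination - h1 - h2
  have hder : ∀ y, y + y₀ ∈ K → derivFt f y (L y + w) ^ 2 = derivFt g y m ^ 2 := by
    intro y hy
    have : derivFt f y (L y + w) = q y * derivFt g y m := by
      simp only [derivFt, ft, Finset.mul_sum]
      refine Finset.sum_congr rfl fun x _ => ?_
      rw [hlin y hy x, sgn_add]
      have hB1 : sgn (B y x) = q (x + y) * q x * q y := by
        have hB2 : B y x = MvPolynomial.eval (x + y) P + MvPolynomial.eval x P +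
            MvPolynomial.eval y P := by
          have h0 := hP y x
          rw [add_comm y x] at h0
          rw [h0]
          have h2 := ZModModule.add_self (MvPolynomial.eval x P)
          have h3 := ZModModule.add_self (MvPolynomial.eval y P)
          linear_combination - h2 - h3
        rw [hB2, sgn_add, sgn_add]
      rw [hB1]
      simp only [g]
      ring
    rw [this, mul_pow]
    simp only [q, sgn_sq, one_mul]
  have hle : (Nat.card K : ℝ) * (c * (2 ^ n) ^ 2) ≤ 2 ^ n * ft g a ^ 2 := by
    refine hy₀.trans (le_trans (Finset.sum_le_sum fun y _ => ?_) (ha m))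
    split_ifs with hy
    · exact (hder y hy).le
    · positivity
  -- The factor `c ^ 2 / 2` is the density of `K`; the remaining `c` is the mass per point of the
  -- coset.
  refine le_of_mul_le_mul_left (a := (2 : ℝ) ^ n) (le_trans ?_ hle) (by positivity)
  calc (2 : ℝ) ^ n * (c ^ 3 / 2 * (2 ^ n) ^ 2) = (c ^ 2 * 2 ^ n) * (c * (2 ^ n) ^ 2) / 2 := by ring
    _ ≤ (2 * Nat.card K) * (c * (2 ^ n) ^ 2) / 2 := by gcongr
    _ = _ := by ring

/-! ### From correlation to distance, and the constants -/

theorem fractionalDist_eq {f g : Cube n → ℝ} (hf : IsBoolean f) (hg : IsBoolean g) :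
    fractionalDist f g = 1 / 2 - (∑ x, f x * g x) / 2 ^ n / 2 := by
  classical
  have h1 : (hammingDist f g : ℝ) = ∑ x, (1 - f x * g x) / 2 := by
    rw [hammingDist, Finset.card_filter, Nat.cast_sum]
    refine Finset.sum_congr rfl fun x _ => ?_
    rcases hf x with h | h <;> rcases hg x with h' | h' <;> norm_num [h, h']
  rw [fractionalDist, h1, ← Finset.sum_div, Finset.sum_sub_distrib]
  simp only [Finset.sum_const, nsmul_eq_mul, Finset.card_univ, card_cube]
  field_simp

/-- The character and the sign of `S` form an affine polynomial, so adding them to `P` keeps the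
degree. As `|S| / 2 ^ n ≤ 1`, it dominates its square, hence `r`. -/
theorem exists_degree_two_close {f : Cube n → ℝ} (hf : IsBoolean f)
    {P : MvPolynomial (Fin n) (ZMod 2)} (hP : P.totalDegree ≤ 2) (a : Cube n) {r : ℝ}
    (h : r * (2 ^ n) ^ 2 ≤ ft (fun x => f x * sgn (MvPolynomial.eval x P)) a ^ 2) :
    ∃ g : Cube n → ℝ, HasDegreeRepresentation 2 g ∧ fractionalDist f g ≤ 1 / 2 - r / 2 := by
  set S := ft (fun x => f x * sgn (MvPolynomial.eval x P)) a with hS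
  have hSle : |S| ≤ 2 ^ n := by
    rw [hS, ft]
    refine (Finset.abs_sum_le_sum_abs _ _).trans ?_
    simp [abs_mul, hf.abs_eq_one]
  have hr : r ≤ |S| / 2 ^ n := by
    have h2 : (0 : ℝ) < 2 ^ n := by positivity
    rw [le_div_iff₀ h2]
    refine le_of_mul_le_mul_right ?_ h2
    calc r * 2 ^ n * 2 ^ n = r * (2 ^ n) ^ 2 := by ring
      _ ≤ |S| * |S| := by rw [abs_mul_abs_self, ← sq]; exact h
      _ ≤ |S| * 2 ^ n := by gcongr
  obtain ⟨b, hb⟩ : ∃ b, sgn b * S = |S| := by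
    rcases abs_cases S with ⟨h, -⟩ | ⟨h, -⟩
    · exact ⟨0, by simp [h]⟩
    · exact ⟨1, by simp [sgn_one, h]⟩
  let Q : MvPolynomial (Fin n) (ZMod 2) :=
    P + (∑ i, MvPolynomial.C (a i) * MvPolynomial.X i + MvPolynomial.C b)
  have hQ : ∀ x, MvPolynomial.eval x Q = MvPolynomial.eval x P + (a ⬝ᵥ x + b) := by
    intro x
    simp [Q, dotProduct]
  have hgb : IsBoolean fun x : Cube n => sgn (MvPolynomial.eval x Q) := fun x =>
    (mul_self_eq_one_iff.1 (sgn_mul_self _)).symm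
  refine ⟨fun x => sgn (MvPolynomial.eval x Q), ⟨Q, ?_, fun x => rfl⟩, ?_⟩
  · refine (MvPolynomial.totalDegree_add _ _).trans (max_le hP ?_)
    refine (MvPolynomial.totalDegree_add _ _).trans (max_le ?_ (by simp))
    refine MvPolynomial.totalDegree_finsetSum_le fun i _ => ?_
    refine (MvPolynomial.totalDegree_mul _ _).trans ?_
    simp
  · rw [fractionalDist_eq hf hgb]
    have : ∑ x, f x * sgn (MvPolynomial.eval x Q) = |S| := by
      rw [← hb, hS, ft, Finset.mul_sum]
      refine Finset.sum_congr rfl fun x _ => ?_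
      rw [hQ, sgn_add, sgn_add]; ring
    rw [this]
    linarith

theorem gowersNorm_three_pow_le_one {f : Cube n → ℝ} (hf : IsBoolean f) : gowersNorm 3 f ^ 8 ≤ 1 := by
  have h : (2 ^ n) ^ 4 * gowersNorm 3 f ^ 8 ≤ (2 ^ n) ^ 4 * 1 := by
    rw [gowersNorm_three_pow]
    have : ∀ y z, derivCorr f y z ^ 2 ≤ (2 ^ n) ^ 2 := by
      intro y z
      refine sq_le_sq' ?_ ?_ <;> [apply neg_le_of_abs_le; apply le_of_abs_le] <;>
      · refine (Finset.abs_sum_le_sum_abs _ _).trans ?_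
        simp [abs_mul, hf.abs_eq_one]
    refine (Finset.sum_le_sum fun y _ => Finset.sum_le_sum fun z _ => this y z).trans ?_
    simp only [Finset.sum_const, nsmul_eq_mul, Finset.card_univ, card_cube]
    exact le_of_eq (by ring)
  exact le_of_mul_le_mul_left h (by positivity)

/-- The value of `t` makes the loss `3 * t` half of `η ^ 2`; `k` converts the triple count to a
density relative to `A`, using `|A| ≤ 2 ^ n / t`; `K` is the resulting doubling constant. -/
theorem exists_large_sum_derivFt {f : Cube n → ℝ} (hf : IsBoolean f) {η t k K : ℝ} (hη : 0 < η)
    (ht : t = η ^ 2 / 6) (hk : k = η ^ 2 * t ^ 2 / 2) (hK : K = 6000 / k ^ 6)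
    (h : η ≤ gowersNorm 3 f ^ 8) :
    ∃ (L : Cube n →ₗ[ZMod 2] Cube n) (w : Cube n),
      t ^ 2 * k * η / (8 * K * 2 ^ (K ^ 4)) * (2 ^ n) ^ 3 ≤ ∑ y, derivFt f y (L y + w) ^ 2 := by
  have ht0 : 0 < t := by rw [ht]; positivity
  have hk0 : 0 < k := by rw [hk]; positivity
  have hK0 : 0 < K := by rw [hK]; positivity
  have hN : (0 : ℝ) < 2 ^ n := by positivity
  set A := largeSpectrum f t with hA
  have htri := card_largeSpectrum_triples hf hη.le ht0.le h
  rw [show η ^ 2 - 3 * t = η ^ 2 / 2 by rw [ht]; ring, ← hA] at htri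
  have hAle := card_largeSpectrum hf t
  rw [← hA] at hAle
  have hP2 : (((A ×ˢ A).filter fun p => p.1 + p.2 ∈ A).card : ℝ) ≤ (A.card : ℝ) ^ 2 := by
    rw [sq, ← Nat.cast_mul, ← Finset.card_product]
    exact_mod_cast Finset.card_filter_le _ _
  have hAge : η / 2 * 2 ^ n ≤ A.card := by
    refine abs_le_of_sq_le_sq' (le_trans ?_ (htri.trans hP2)) (by positivity) |>.2
    nlinarith [mul_pos hη hN]
  have hAne : A.Nonempty := by
    rw [← Finset.card_pos]
    have : (0 : ℝ) < A.card := lt_of_lt_of_le (by positivity) hAge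
    exact_mod_cast this
  have hkA : k * (A.card : ℝ) ^ 2 ≤ (((A ×ˢ A).filter fun p => p.1 + p.2 ∈ A).card : ℝ) := by
    refine le_trans ?_ htri
    calc k * (A.card : ℝ) ^ 2 = η ^ 2 / 2 * (t * A.card) ^ 2 := by rw [hk]; ring
      _ ≤ η ^ 2 / 2 * (2 ^ n) ^ 2 := by gcongr
  obtain ⟨D, hDA, hDcard, hDD⟩ := exists_small_difference_of_many_triples hk0 hAne hkA
  rw [← hK] at hDD
  have hDpos : (0 : ℝ) < D.card := by
    have : (0 : ℝ) < A.card := by exact_mod_cast hAne.card_pos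
    exact lt_of_lt_of_le (by positivity) hDcard
  have hDne : D.Nonempty := by
    rw [← Finset.card_pos]; exact_mod_cast hDpos
  have hspan := card_span_le_of_small_difference hDne hDD
  obtain ⟨L, w, hLw⟩ := exists_affine_section (D := D) (t := t) fun y => by
    refine le_trans ?_ (card_largeSpectrum_fiber hf t y)
    gcongr
  refine ⟨L, w, ?_⟩
  set Y := Finset.univ.filter fun y => (y, L y + w) ∈ D
  have hY : t * D.card ≤ Y.card * (2 ^ (K ^ 4) * K) := by
    refine le_of_mul_le_mul_right ?_ hDpos
    calc t * D.card * D.card = t * (D.card : ℝ) ^ 2 := by ring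
      _ ≤ _ := hLw
      _ ≤ Y.card * (2 ^ (K ^ 4) * (K * D.card)) := by gcongr
      _ = _ := by ring
  have hsum : Y.card * (t * (2 ^ n) ^ 2) ≤ ∑ y, derivFt f y (L y + w) ^ 2 := by
    rw [← nsmul_eq_mul, ← Finset.sum_const]
    refine (Finset.sum_le_sum fun y hy => ?_).trans
      (Finset.sum_le_sum_of_subset_of_nonneg (Finset.subset_univ Y) fun _ _ _ => sq_nonneg _)
    exact (mem_largeSpectrum (p := (y, L y + w))).1 (hDA (Finset.mem_filter.1 hy).2)
  refine le_trans ?_ hsum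
  rw [div_mul_eq_mul_div, div_le_iff₀ (by positivity)]
  have hD2 : k * η / 8 * 2 ^ n ≤ D.card := by
    refine le_trans ?_ hDcard
    calc k * η / 8 * 2 ^ n = k / 4 * (η / 2 * 2 ^ n) := by ring
      _ ≤ _ := by gcongr
  calc t ^ 2 * k * η * (2 ^ n) ^ 3 = 8 * t * (2 ^ n) ^ 2 * (t * (k * η / 8 * 2 ^ n)) := by ring
    _ ≤ 8 * t * (2 ^ n) ^ 2 * (t * D.card) := by gcongr
    _ ≤ 8 * t * (2 ^ n) ^ 2 * (Y.card * (2 ^ (K ^ 4) * K)) := by gcongr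
    _ = _ := by ring

/-- Every loss is absorbed by `K`, since `k ≤ t ≤ η` and `1 ≤ K * k`. This leaves three factors `K ^
4` and one `2 ^ (K ^ 4)`, each at most `exp (K ^ 4)`. -/
theorem exp_neg_le_correlation {η t k K : ℝ} (hη : 0 < η) (hη1 : η ≤ 1)
    (ht : t = η ^ 2 / 6) (hk : k = η ^ 2 * t ^ 2 / 2) (hK : K = 6000 / k ^ 6) :
    Real.exp (-(4 * K ^ 4)) ≤ t ^ 2 * k * η / (8 * K * 2 ^ (K ^ 4)) := by
  have ht0 : 0 < t := by rw [ht]; positivity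
  have hk0 : 0 < k := by rw [hk]; positivity
  have hη2 : η ^ 2 ≤ 1 := pow_le_one₀ hη.le hη1
  have ht1 : t ≤ 1 := by rw [ht]; linarith
  have hkt : k ≤ t := by
    rw [hk]
    nlinarith [mul_le_mul hη2 ht1 ht0.le zero_le_one]
  have htη : t ≤ η := by rw [ht]; nlinarith
  have hk1 : k ≤ 1 := hkt.trans ht1
  have hkK : 1 ≤ K * k := by
    rw [hK, div_mul_eq_mul_div, le_div_iff₀ (by positivity)]
    have : k ^ 6 ≤ k := pow_le_of_le_one hk0.le hk1 (by norm_num)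
    linarith
  have hK8 : 8 ≤ K := by
    rw [hK, le_div_iff₀ (by positivity)]
    have : k ^ 6 ≤ 1 := pow_le_one₀ hk0.le hk1
    linarith
  have hK0 : 0 < K := by linarith
  have hKZ : K ≤ K ^ 4 := le_self_pow₀ (by linarith) (by norm_num)
  rw [Real.exp_neg, inv_le_comm₀ (by positivity) (by positivity), inv_div]
  have hnum : 1 ≤ K ^ 4 * (t ^ 2 * k * η) := by
    calc (1 : ℝ) ≤ (K * k) ^ 4 := one_le_pow₀ hkK
      _ = K ^ 4 * (k ^ 2 * k * k) := by ring
      _ ≤ K ^ 4 * (t ^ 2 * k * η) := by gcongr; exact hkt.trans htη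
  have hZ : K ^ 4 ≤ Real.exp (K ^ 4) := by linarith [Real.add_one_le_exp (K ^ 4)]
  have h2 : (2 : ℝ) ^ (K ^ 4) ≤ Real.exp (K ^ 4) := by
    rw [Real.rpow_def_of_pos two_pos]
    refine Real.exp_le_exp.2 (mul_le_of_le_one_left (by positivity) ?_)
    linarith [Real.log_two_lt_d9]
  rw [div_le_iff₀ (by positivity)]
  calc 8 * K * 2 ^ (K ^ 4) ≤ K ^ 4 * K ^ 4 * Real.exp (K ^ 4) := by
        gcongr; exact hK8.trans hKZ
    _ ≤ K ^ 4 * K ^ 4 * Real.exp (K ^ 4) * (K ^ 4 * (t ^ 2 * k * η)) :=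
        le_mul_of_one_le_right (by positivity) hnum
    _ = (K ^ 4 * K ^ 4 * K ^ 4 * Real.exp (K ^ 4)) * (t ^ 2 * k * η) := by ring
    _ ≤ (Real.exp (K ^ 4) * Real.exp (K ^ 4) * Real.exp (K ^ 4) * Real.exp (K ^ 4)) *
          (t ^ 2 * k * η) := by gcongr
    _ = Real.exp (4 * K ^ 4) * (t ^ 2 * k * η) := by
        rw [← Real.exp_add, ← Real.exp_add, ← Real.exp_add]; ring_nf

theorem mainTheorem1 :
    ∃ C c : ℝ, 0 < C ∧ 0 < c ∧
      ∀ (n : ℕ) (f : Cube n → ℝ) (ε : ℝ), IsBoolean f → 0 < ε → ε ≤ gowersNorm 3 f →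
        ∃ g : Cube n → ℝ, HasDegreeRepresentation 2 g ∧
          fractionalDist f g ≤ 1 / 2 - c * Real.exp (-(1 / ε ^ C)) := by
  -- With `η = ε ^ 8` one has `k = ε ^ 48 / 72`, so `12 * K ^ 4 = a / ε ^ 1152`; the 12 is 4 times 3
  -- because `r` is cubed. Then `a * X ≤ X ^ 2 + a ^ 2` moves `a` into the constant and doubles the
  -- exponent to 2304. The quarter comes from `r ^ 3 / 2`, halved again in the distance.
  obtain ⟨a, ha⟩ : ∃ a : ℝ, a = 12 * (6000 * 72 ^ 6) ^ 4 := ⟨_, rfl⟩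
  refine ⟨(2304 : ℕ), Real.exp (-(a ^ 2)) / 4, by norm_num, by positivity, ?_⟩
  intro n f ε hf hε hle
  have hε8 : ε ^ 8 ≤ gowersNorm 3 f ^ 8 := pow_le_pow_left₀ hε.le hle 8
  have hη0 : 0 < ε ^ 8 := by positivity
  have hη1 : ε ^ 8 ≤ 1 := hε8.trans (gowersNorm_three_pow_le_one hf)
  obtain ⟨t, ht⟩ : ∃ t : ℝ, t = (ε ^ 8) ^ 2 / 6 := ⟨_, rfl⟩
  obtain ⟨k, hk⟩ : ∃ k : ℝ, k = (ε ^ 8) ^ 2 * t ^ 2 / 2 := ⟨_, rfl⟩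
  obtain ⟨K, hK⟩ : ∃ K : ℝ, K = 6000 / k ^ 6 := ⟨_, rfl⟩
  obtain ⟨L, w, hLw⟩ := exists_large_sum_derivFt hf hη0 ht hk hK hε8
  have hexp := exp_neg_le_correlation hη0 hη1 ht hk hK
  set r := t ^ 2 * k * ε ^ 8 / (8 * K * 2 ^ (K ^ 4))
  have hr0 : 0 ≤ r := (Real.exp_pos _).le.trans hexp
  obtain ⟨P, α, hP, hcorr⟩ := exists_quadratic_correlation hf L w hr0 hLw
  obtain ⟨g, hg, hdist⟩ := exists_degree_two_close hf hP α hcorr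
  refine ⟨g, hg, hdist.trans ?_⟩
  have hKX : 12 * K ^ 4 = a * (1 / ε ^ 1152) := by
    rw [hK, hk, ht, ha]
    field_simp
    norm_num
  have hbound : 12 * K ^ 4 ≤ 1 / ε ^ ((2304 : ℕ) : ℝ) + a ^ 2 := by
    rw [hKX, Real.rpow_natCast, show 1 / ε ^ 2304 = (1 / ε ^ 1152) ^ 2 by
      rw [div_pow, ← pow_mul, one_pow]]
    nlinarith [sq_nonneg (a - 1 / ε ^ 1152), sq_nonneg a, sq_nonneg (1 / ε ^ 1152)]
  have h3 : Real.exp (-(a ^ 2)) * Real.exp (-(1 / ε ^ ((2304 : ℕ) : ℝ))) ≤ r ^ 3 := by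
    calc _ ≤ Real.exp (-(12 * K ^ 4)) := by
          rw [← Real.exp_add]
          exact Real.exp_le_exp.2 (by linarith)
      _ = Real.exp (-(4 * K ^ 4)) ^ 3 := by
          rw [← Real.exp_nat_mul]; congr 1; push_cast; ring
      _ ≤ r ^ 3 := by gcongr
  linarith
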